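/- Let $k$ be a field, let $W\in k[x_1,\dots,x_n]$ have an isolated singularity in the sense that the Jacobian algebra $\mathrm{Jac}(W)=k[x_1,\dots,x_n]/(\partial_1W,\dots,\partial_nW)$ is finite dimensional over $k$, and let $G$ be a finite abelian group acting diagonally, $g\cdot x_i=g_ix_i$ with $g_i\in k^*$, such that $W(gx)=W(x)$ for all $g\in G$. Put $I_g=\{i : g_i\neq 1\}$, $S=k[x_1,\dots,x_n,y_1,\dots,y_n]$ and $$\nabla_iW(x,y)=\frac{W(y_1,\dots,y_i,x_{i+1},\dots,x_n)-W(y_1,\dots,y_{i-1},x_i,\dots,x_n)}{y_i-x_i}.$$ For $g\in G$ let $\Delta_g$ be the matrix factorization of $W(y)-W(x)$ given by the $\mathbb Z/2$-graded free module $S[\theta_1,\dots,\theta_n]$ ($\theta_i$ odd and anticommuting, $\theta_i^2=0$) with the differential $\sum_i\big((y_i-gx_i)\theta_i+\nabla_iW(gx,y)\,\partial_i\big)$, where $\partial_i$ is the contraction with $\partial_i\theta_j+\theta_j\partial_i=\delta_{ij}$. Let $hom(\Delta_1,\Delta_h)$ be the $\mathbb Z/2$-graded complex of all $S$-linear maps,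 with the differential given by $D\phi=d_{\Delta_h}\phi+(-1)^{|\phi|+1}\phi\, d_{\Delta_1}$ for homogeneous $\phi$, and let $\mathrm{Hom}(\Delta_1,\Delta_h)$ be its cohomology. Every $\phi\in hom(\Delta_1,\Delta_h)$ has a unique expansion $\phi=\sum_{I,J}f_{IJ}\theta_I\partial_J$ with $f_{IJ}\in S$, where $\theta_I$ and $\partial_J$ are the products in increasing order of indices; the coefficient of $\theta_{I_h}$ in $\phi$ is $f_{I_h\emptyset}$. For $\phi\in hom(\Delta_1,\Delta_g)$ and $\psi\in hom(\Delta_1,\Delta_h)$ put $\phi\cup\psi=(h_*\phi)\circ\psi\in hom(\Delta_1,\Delta_{gh})$, where for $r\in S$ $$(h_*\phi)(r\,\theta_I)=r\cdot(1\times h^{-1})\cdot\phi(\rho(h)\theta_I),\qquad (1\times b)\cdot\big(r(x,y)\theta_I\big)=r(x,by)\,\rho(b)\theta_I,\qquad \rho(b)\theta_I=\prod_{i\in I}b_i^{-1}\,\theta_I .$$ This induces a product $\cup:\mathrm{Hom}(\Delta_1,\Delta_g)\times\mathrm{Hom}(\Delta_1,\Delta_h)\to\mathrm{Hom}(\Delta_1,\Delta_{gh})$.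 Then the following hold. 1. For every $h\in G$, if $\phi\in hom(\Delta_1,\Delta_h)$ is closed and the coefficient of $\theta_{I_h}$ in $\phi$ is zero, then $\phi$ is nullhomotopic, i.e. $\phi=Ds$ for some $s\in hom(\Delta_1,\Delta_h)$. 2. For every $h\in G$, if $\phi,\phi'\in hom(\Delta_1,\Delta_h)$ are closed and have the same coefficient of $\theta_{I_h}$, then $[\phi]=[\phi']$ in $\mathrm{Hom}(\Delta_1,\Delta_h)$. 3. Let $g,h\in G$ and let $\phi\in hom(\Delta_1,\Delta_g)$, $\psi\in hom(\Delta_1,\Delta_h)$ be closed. If $\omega\in hom(\Delta_1,\Delta_{gh})$ is closed and its coefficient of $\theta_{I_{gh}}$ equals that of $(h_*\phi)\circ\psi$, then $[\phi]\cup[\psi]=[\omega]$. Moreover, $[\phi]\cup[\psi]$ depends only on the coefficient of $\theta_{I_g}$ in $\phi$ and the coefficient of $\theta_{I_h}$ in $\psi$. -/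

import Mathlib

open MvPolynomial

universe u

namespace TwistedMF

noncomputable section

/-! ### Matrix factorizations, their morphism complexes, and cohomology -/

/-- A matrix factorization of `w` over the commutative ring `A`: a free `ℤ/2`-graded module
`P = P⁰ ⊕ P¹` with an odd endomorphism `d` such that `d² = w · id`. -/
structure MatrixFactorization (A : Type u) [CommRing A] (w : A) where
  carrier : Type u
  [addCommGroup : AddCommGroup carrier]
  [module : Module A carrier]
  part : ZMod 2 → Submodule A carrier
  free_part : ∀ j, Module.Free A (part j)
  isCompl : IsCompl (part 0) (part 1)
  d : carrier →ₗ[A] carrier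
  d_mem : ∀ j, ∀ p ∈ part j, d p ∈ part (j + 1)
  d_sq : ∀ p, d (d p) = w • p

attribute [instance] MatrixFactorization.addCommGroup MatrixFactorization.module

namespace MatrixFactorization

variable {A : Type u} [CommRing A] {w : A}

/-- All `A`-linear maps `P → Q`; this is the sum of its homogeneous parts of degree `0` and `1`. -/
abbrev hom (P Q : MatrixFactorization A w) : Type u := P.carrier →ₗ[A] Q.carrier

/-- `φ` is a morphism of degree `j ∈ ℤ/2`. -/
def HasDegree {P Q : MatrixFactorization A w} (j : ZMod 2) (φ : hom P Q) : Prop :=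
  ∀ i, ∀ p ∈ P.part i, φ p ∈ Q.part (i + j)

/-- The grading involution: `+1` on `P⁰` and `-1` on `P¹`. -/
def sgn (P : MatrixFactorization A w) : hom P P :=
  (P.part 0).projection (P.part 1) P.isCompl - (P.part 1).projection (P.part 0) P.isCompl.symm

theorem sgn_of_mem_zero (P : MatrixFactorization A w) {p : P.carrier} (hp : p ∈ P.part 0) :
    P.sgn p = p := by
  rw [sgn, LinearMap.sub_apply, Submodule.projection_apply_of_mem_left _ hp,
    Submodule.projection_apply_of_mem_right _ hp, sub_zero]

theorem sgn_of_mem_one (P : MatrixFactorization A w) {p : P.carrier} (hp : p ∈ P.part 1) :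
    P.sgn p = -p := by
  rw [sgn, LinearMap.sub_apply, Submodule.projection_apply_of_mem_left _ hp,
    Submodule.projection_apply_of_mem_right _ hp, zero_sub]

/-- To check an identity of linear maps out of `P` it suffices to check it on homogeneous
elements. -/
theorem ext_part {P : MatrixFactorization A w} {M : Type*} [AddCommGroup M] [Module A M]
    {f g : P.carrier →ₗ[A] M} (h0 : ∀ p ∈ P.part 0, f p = g p) (h1 : ∀ p ∈ P.part 1, f p = g p) :
    f = g := by
  ext p
  have hp : p ∈ P.part 0 ⊔ P.part 1 := by rw [P.isCompl.sup_eq_top]; trivial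
  obtain ⟨a, ha, b, hb, rfl⟩ := Submodule.mem_sup.1 hp
  rw [map_add, map_add, h0 a ha, h1 b hb]

theorem sgn_sgn (P : MatrixFactorization A w) (p : P.carrier) : P.sgn (P.sgn p) = p := by
  have : P.sgn ∘ₗ P.sgn = LinearMap.id := by
    refine ext_part (fun p hp => ?_) (fun p hp => ?_)
    · simp [P.sgn_of_mem_zero hp]
    · simp [P.sgn_of_mem_one hp]
  exact LinearMap.congr_fun this p

theorem d_sgn (P : MatrixFactorization A w) (p : P.carrier) : P.d (P.sgn p) = -P.sgn (P.d p) := by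
  have : P.d ∘ₗ P.sgn = -(P.sgn ∘ₗ P.d) := by
    refine ext_part (fun p hp => ?_) (fun p hp => ?_)
    · simp [P.sgn_of_mem_zero hp, P.sgn_of_mem_one (P.d_mem 0 p hp)]
    · have h : P.d p ∈ P.part 0 := P.d_mem 1 p hp
      simp [P.sgn_of_mem_one hp, P.sgn_of_mem_zero h]
  exact LinearMap.congr_fun this p

/-- The differential `D φ = d' ∘ φ + (-1)^{|φ|+1} φ ∘ d` of the morphism complex, extended
additively from homogeneous morphisms to all of `hom P Q`; see `D_of_hasDegree`. -/
def D (P Q : MatrixFactorization A w) : hom P Q →ₗ[A] hom P Q where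
  toFun φ := Q.d ∘ₗ φ - (Q.sgn ∘ₗ φ ∘ₗ P.sgn) ∘ₗ P.d
  map_add' φ ψ := by ext p; simp; abel
  map_smul' c φ := by ext p; simp [smul_sub]

theorem D_apply {P Q : MatrixFactorization A w} (φ : hom P Q) (p : P.carrier) :
    D P Q φ p = Q.d (φ p) - Q.sgn (φ (P.sgn (P.d p))) := rfl

theorem D_of_hasDegree {P Q : MatrixFactorization A w} {j : ZMod 2} {φ : hom P Q}
    (hφ : HasDegree j φ) : D P Q φ = Q.d ∘ₗ φ + ((-1 : A) ^ (j.val + 1)) • (φ ∘ₗ P.d) := by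
  have key : Q.sgn ∘ₗ φ ∘ₗ P.sgn = ((-1 : A) ^ j.val) • φ := by
    have hj : j = 0 ∨ j = 1 := (by decide : ∀ j : ZMod 2, j = 0 ∨ j = 1) j
    refine ext_part (fun p hp => ?_) (fun p hp => ?_) <;> rcases hj with rfl | rfl
    · have h : φ p ∈ Q.part 0 := hφ 0 p hp
      simp [P.sgn_of_mem_zero hp, Q.sgn_of_mem_zero h]
    · have h : φ p ∈ Q.part 1 := hφ 0 p hp
      simp [P.sgn_of_mem_zero hp, Q.sgn_of_mem_one h, ZMod.val_one]
    · have h : φ p ∈ Q.part 1 := hφ 1 p hp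
      simp [P.sgn_of_mem_one hp, Q.sgn_of_mem_one h]
    · have h : φ p ∈ Q.part 0 := hφ 1 p hp
      simp [P.sgn_of_mem_one hp, Q.sgn_of_mem_zero h, ZMod.val_one]
  ext p
  have := LinearMap.congr_fun key (P.d p)
  simp only [LinearMap.comp_apply, LinearMap.smul_apply] at this
  simp only [D_apply, this, LinearMap.add_apply, LinearMap.comp_apply, LinearMap.smul_apply,
    LinearMap.neg_apply, pow_succ, mul_neg, mul_one, neg_smul, sub_eq_add_neg]

/-- `φ` is closed. -/
def IsClosed {P Q : MatrixFactorization A w} (φ : hom P Q) : Prop := D P Q φ = 0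

/-- `φ` is nullhomotopic: `φ = D s` for a homotopy `s`. -/
def IsNullhomotopic {P Q : MatrixFactorization A w} (φ : hom P Q) : Prop :=
  ∃ s : hom P Q, D P Q s = φ

theorem D_D {P Q : MatrixFactorization A w} (φ : hom P Q) : D P Q (D P Q φ) = 0 := by
  ext p
  simp only [D_apply, map_sub, d_sq, d_sgn, map_neg, sgn_sgn, LinearMap.map_smul, LinearMap.zero_apply]
  abel

/-- The module of closed morphisms. -/
def cycles (P Q : MatrixFactorization A w) : Submodule A (hom P Q) := LinearMap.ker (D P Q)

/-- The closed morphisms that are nullhomotopic (all boundaries are closed by `D_D`). -/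
def boundaries (P Q : MatrixFactorization A w) : Submodule A (cycles P Q) :=
  (LinearMap.range (D P Q)).submoduleOf (cycles P Q)

/-- `Hom(P, Q)`, the cohomology of the morphism complex. -/
abbrev Hom (P Q : MatrixFactorization A w) : Type u := cycles P Q ⧸ boundaries P Q

/-- The cohomology class of a closed morphism. -/
def cls {P Q : MatrixFactorization A w} (φ : hom P Q) (hφ : IsClosed φ) : Hom P Q :=
  Submodule.Quotient.mk ⟨φ, hφ⟩

theorem cls_eq_cls {P Q : MatrixFactorization A w} {φ ψ : hom P Q} (hφ : IsClosed φ)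
    (hψ : IsClosed ψ) : cls φ hφ = cls ψ hψ ↔ IsNullhomotopic (φ - ψ) := by
  rw [cls, cls, Submodule.Quotient.eq]
  rfl

/-- The Leibniz rule for composition. -/
theorem D_comp {P Q T : MatrixFactorization A w} (α : hom Q T) (β : hom P Q) :
    D P T (α ∘ₗ β) = D Q T α ∘ₗ β + (T.sgn ∘ₗ α ∘ₗ Q.sgn) ∘ₗ D P Q β := by
  ext p
  simp only [D_apply, LinearMap.add_apply, LinearMap.comp_apply, map_sub, sgn_sgn]
  abel

theorem D_conj {P Q : MatrixFactorization A w} (α : hom P Q) :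
    D P Q (Q.sgn ∘ₗ α ∘ₗ P.sgn) = -(Q.sgn ∘ₗ D P Q α ∘ₗ P.sgn) := by
  ext p
  simp only [D_apply, LinearMap.neg_apply, LinearMap.comp_apply, map_sub, d_sgn, sgn_sgn, map_neg]
  abel

theorem IsClosed.comp {P Q T : MatrixFactorization A w} {α : hom Q T} {β : hom P Q}
    (hα : IsClosed α) (hβ : IsClosed β) : IsClosed (P := P) (Q := T) (α ∘ₗ β) := by
  unfold IsClosed at *
  rw [D_comp, hα, hβ, LinearMap.zero_comp, LinearMap.comp_zero, add_zero]

theorem IsNullhomotopic.comp_right {P Q T : MatrixFactorization A w} {α : hom Q T} {β : hom P Q}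
    (hα : IsNullhomotopic α) (hβ : IsClosed β) :
    IsNullhomotopic (P := P) (Q := T) (α ∘ₗ β) := by
  obtain ⟨s, rfl⟩ := hα
  unfold IsClosed at hβ
  exact ⟨s ∘ₗ β, by rw [D_comp, hβ, LinearMap.comp_zero, add_zero]⟩

theorem IsNullhomotopic.comp_left {P Q T : MatrixFactorization A w} {α : hom Q T} {β : hom P Q}
    (hα : IsClosed α) (hβ : IsNullhomotopic β) :
    IsNullhomotopic (P := P) (Q := T) (α ∘ₗ β) := by
  obtain ⟨s, rfl⟩ := hβ
  unfold IsClosed at hα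
  refine ⟨(T.sgn ∘ₗ α ∘ₗ Q.sgn) ∘ₗ s, ?_⟩
  rw [D_comp, D_conj, hα]
  ext p
  simp [sgn_sgn]

end MatrixFactorization

/-! ### The free module `A[θ₁, …, θₙ]` and the Clifford operators -/

section Koszul

variable {n : ℕ} {A : Type u} [CommRing A]

/-- `A[θ₁, …, θₙ]`, the free module with basis `θ_I`, `I ⊆ {1, …, n}`: an element is the family of
its coefficients. -/
abbrev ExtMod (n : ℕ) (A : Type u) : Type u := Finset (Fin n) → A

/-- The basis element `θ_I`. -/
def thetaBasis (A : Type u) [CommRing A] (I : Finset (Fin n)) : ExtMod n A := Pi.single I 1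

/-- The Koszul sign `(-1)^{#{j ∈ I : j < i}}`. -/
def kSign (A : Type u) [CommRing A] (i : Fin n) (I : Finset (Fin n)) : A :=
  (-1) ^ (I.filter (· < i)).card

/-- Left multiplication by `θ_i` on `A[θ₁, …, θₙ]`. -/
def theta (A : Type u) [CommRing A] (i : Fin n) : ExtMod n A →ₗ[A] ExtMod n A where
  toFun v I := if i ∈ I then kSign A i I * v (I.erase i) else 0
  map_add' v v' := by ext I; by_cases h : i ∈ I <;> simp [h, mul_add]
  map_smul' c v := by ext I; by_cases h : i ∈ I <;> simp [h, mul_left_comm]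

/-- The contraction `∂_i` on `A[θ₁, …, θₙ]`. -/
def del (A : Type u) [CommRing A] (i : Fin n) : ExtMod n A →ₗ[A] ExtMod n A where
  toFun v I := if i ∈ I then 0 else kSign A i I * v (insert i I)
  map_add' v v' := by ext I; by_cases h : i ∈ I <;> simp [h, mul_add]
  map_smul' c v := by ext I; by_cases h : i ∈ I <;> simp [h, mul_left_comm]

theorem theta_apply (i : Fin n) (v : ExtMod n A) (I : Finset (Fin n)) :
    theta A i v I = if i ∈ I then kSign A i I * v (I.erase i) else 0 := rfl

theorem del_apply (i : Fin n) (v : ExtMod n A) (I : Finset (Fin n)) :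
    del A i v I = if i ∈ I then 0 else kSign A i I * v (insert i I) := rfl

theorem kSign_mul_self (i : Fin n) (I : Finset (Fin n)) : kSign A i I * kSign A i I = 1 := by
  rw [kSign, ← mul_pow]; simp

theorem kSign_insert_of_lt {i j : Fin n} {I : Finset (Fin n)} (h : j < i) (hj : j ∉ I) :
    kSign A i (insert j I) = -kSign A i I := by
  rw [kSign, kSign, Finset.filter_insert, if_pos h, Finset.card_insert_of_notMem (by simp [hj]),
    pow_succ, mul_neg_one]

theorem kSign_insert_of_le {i j : Fin n} {I : Finset (Fin n)} (h : i ≤ j) :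
    kSign A i (insert j I) = kSign A i I := by
  rw [kSign, kSign, Finset.filter_insert, if_neg (not_lt.2 h)]

theorem kSign_erase_of_lt {i j : Fin n} {I : Finset (Fin n)} (h : j < i) (hj : j ∈ I) :
    kSign A i (I.erase j) = -kSign A i I := by
  conv_rhs => rw [← Finset.insert_erase hj, kSign_insert_of_lt h (Finset.notMem_erase j I)]
  rw [neg_neg]

theorem kSign_erase_of_le {i j : Fin n} {I : Finset (Fin n)} (h : i ≤ j) :
    kSign A i (I.erase j) = kSign A i I := by
  by_cases hj : j ∈ I
  · conv_rhs => rw [← Finset.insert_erase hj, kSign_insert_of_le h]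
  · rw [Finset.erase_eq_of_notMem hj]

theorem theta_mul_self (i : Fin n) : theta A i * theta A i = 0 := by
  ext v I
  simp [theta_apply, Module.End.mul_apply]

theorem del_mul_self (i : Fin n) : del A i * del A i = 0 := by
  refine LinearMap.ext fun v => funext fun I => ?_
  simp [del_apply, Module.End.mul_apply]

theorem theta_anticomm {i j : Fin n} (h : i ≠ j) :
    theta A i * theta A j = -(theta A j * theta A i) := by
  wlog hij : i < j generalizing i j
  · rw [this h.symm (lt_of_le_of_ne (not_lt.1 hij) h.symm), neg_neg]
  refine LinearMap.ext fun v => funext fun I => ?_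
  simp only [Module.End.mul_apply, LinearMap.neg_apply, Pi.neg_apply, theta_apply,
    Finset.mem_erase]
  by_cases hi : i ∈ I <;> by_cases hj : j ∈ I <;> simp [hi, hj, h, h.symm]
  rw [kSign_erase_of_lt hij hi, kSign_erase_of_le hij.le, Finset.erase_right_comm]
  ring

theorem del_anticomm {i j : Fin n} (h : i ≠ j) :
    del A i * del A j = -(del A j * del A i) := by
  wlog hij : i < j generalizing i j
  · rw [this h.symm (lt_of_le_of_ne (not_lt.1 hij) h.symm), neg_neg]
  refine LinearMap.ext fun v => funext fun I => ?_
  simp only [Module.End.mul_apply, LinearMap.neg_apply, Pi.neg_apply, del_apply,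
    Finset.mem_insert]
  by_cases hi : i ∈ I <;> by_cases hj : j ∈ I <;> simp [hi, hj, h, h.symm]
  rw [kSign_insert_of_lt hij hi, kSign_insert_of_le hij.le, Finset.insert_comm]
  ring

theorem del_mul_theta (i j : Fin n) :
    del A i * theta A j = -(theta A j * del A i) + if i = j then 1 else 0 := by
  refine LinearMap.ext fun v => funext fun I => ?_
  rcases eq_or_ne i j with rfl | h
  · by_cases hi : i ∈ I
    · simp [Module.End.mul_apply, theta_apply, del_apply, hi, ← mul_assoc, kSign_erase_of_le,
        kSign_mul_self]
    · simp [Module.End.mul_apply, theta_apply, del_apply, hi, ← mul_assoc, kSign_insert_of_le,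
        kSign_mul_self]
  · simp only [Module.End.mul_apply, LinearMap.add_apply, LinearMap.neg_apply, Pi.neg_apply,
      Pi.add_apply, theta_apply, del_apply, Finset.mem_insert, Finset.mem_erase, if_neg h]
    by_cases hi : i ∈ I <;> by_cases hj : j ∈ I <;> simp [hi, hj, h, h.symm]
    rw [Finset.erase_insert_of_ne h]
    rcases lt_or_gt_of_ne h with hij | hij
    · rw [kSign_insert_of_lt hij hi, kSign_erase_of_le hij.le]; ring
    · rw [kSign_insert_of_le hij.le, kSign_erase_of_lt hij hj]; ring

theorem sum_smul_mul_self {ι M : Type*} [Ring M] [Algebra A M] (s : Finset ι)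
    (c : ι → A) (X : ι → M) (h0 : ∀ i, X i * X i = 0)
    (h1 : ∀ i j, i ≠ j → X i * X j = -(X j * X i)) :
    (∑ i ∈ s, c i • X i) * (∑ i ∈ s, c i • X i) = 0 := by
  classical
  induction s using Finset.induction_on with
  | empty => simp
  | insert a s ha ih =>
    have hc : (c a • X a) * (∑ i ∈ s, c i • X i) = -((∑ i ∈ s, c i • X i) * (c a • X a)) := by
      rw [Finset.mul_sum, Finset.sum_mul, ← Finset.sum_neg_distrib]
      refine Finset.sum_congr rfl fun i hi => ?_
      have : a ≠ i := fun h => ha (h ▸ hi)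
      rw [smul_mul_smul_comm, smul_mul_smul_comm, h1 a i this, smul_neg, mul_comm]
    rw [Finset.sum_insert ha, add_mul, mul_add, mul_add, ih, hc, smul_mul_smul_comm, h0]
    simp

/-- The Koszul differential `∑ (a_i θ_i + b_i ∂_i)`. -/
def koszulD (a b : Fin n → A) : ExtMod n A →ₗ[A] ExtMod n A :=
  ∑ i, (a i • theta A i + b i • del A i)

theorem koszulD_mul_self (a b : Fin n → A) :
    koszulD a b * koszulD a b = (∑ i, a i * b i) • (1 : Module.End A (ExtMod n A)) := by
  have hT := sum_smul_mul_self Finset.univ a (theta A) theta_mul_self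
    (fun i j h => theta_anticomm (A := A) h)
  have hB := sum_smul_mul_self Finset.univ b (del A) del_mul_self
    (fun i j h => del_anticomm (A := A) h)
  have hTB : (∑ i, b i • del A i) * (∑ i, a i • theta A i)
      = -((∑ i, a i • theta A i) * (∑ i, b i • del A i))
        + (∑ i, a i * b i) • (1 : Module.End A (ExtMod n A)) := by
    rw [Finset.sum_mul_sum, Finset.sum_mul_sum, Finset.sum_comm, Finset.sum_smul,
      ← Finset.sum_neg_distrib, ← Finset.sum_add_distrib]
    refine Finset.sum_congr rfl fun i _ => ?_
    rw [← Finset.sum_neg_distrib]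
    have : ∀ j ∈ Finset.univ, b j • del A j * a i • theta A i
        = -(a i • theta A i * b j • del A j)
          + if j = i then (a i * b i) • (1 : Module.End A (ExtMod n A)) else 0 := by
      intro j _
      rw [smul_mul_smul_comm, smul_mul_smul_comm, del_mul_theta, smul_add, smul_neg, mul_comm (b j)]
      by_cases h : j = i
      · subst h; simp
      · simp [h]
    rw [Finset.sum_congr rfl this, Finset.sum_add_distrib]
    simp
  rw [koszulD, Finset.sum_add_distrib, add_mul, mul_add, mul_add, hT, hB, hTB]
  abel

/-- The part of `A[θ₁, …, θₙ]` spanned by the `θ_I` with `|I| ≡ j mod 2`. -/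
def extPart (n : ℕ) (A : Type u) [CommRing A] (j : ZMod 2) : Submodule A (ExtMod n A) where
  carrier := {v | ∀ I, (I.card : ZMod 2) ≠ j → v I = 0}
  add_mem' hv hw I hI := by simp [hv I hI, hw I hI]
  zero_mem' I _ := rfl
  smul_mem' c v hv I hI := by simp [hv I hI]

theorem free_extPart (j : ZMod 2) : Module.Free A (extPart n A j) := by
  let e : extPart n A j ≃ₗ[A] ({I : Finset (Fin n) // (I.card : ZMod 2) = j} → A) :=
    { toFun := fun v I => v.1 I.1
      map_add' := fun _ _ => rfl
      map_smul' := fun _ _ => rfl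
      invFun := fun f => ⟨fun I => if h : (I.card : ZMod 2) = j then f ⟨I, h⟩ else 0,
        fun I hI => by simp [hI]⟩
      left_inv := fun v => by
        ext I
        by_cases h : (I.card : ZMod 2) = j
        · simp [h]
        · simp [h, v.2 I h]
      right_inv := fun f => by
        ext I
        simp [I.2] }
  exact Module.Free.of_equiv e.symm

theorem isCompl_extPart : IsCompl (extPart n A 0) (extPart n A 1) := by
  have h01 : ∀ j : ZMod 2, j ≠ 0 → j = 1 := by decide
  rw [isCompl_iff, Submodule.disjoint_def, codisjoint_iff, eq_top_iff]
  refine ⟨fun v h0 h1 => ?_, fun v _ => ?_⟩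
  · ext I
    by_cases h : (I.card : ZMod 2) = 0
    · exact h1 I (by rw [h]; decide)
    · exact h0 I h
  · refine Submodule.mem_sup.2 ⟨fun I => if (I.card : ZMod 2) = 0 then v I else 0,
      fun I hI => by simp [hI], fun I => if (I.card : ZMod 2) = 0 then 0 else v I,
      fun I hI => ?_, ?_⟩
    · by_cases h : (I.card : ZMod 2) = 0
      · simp [h]
      · exact absurd (h01 _ h) hI
    · ext I
      by_cases h : (I.card : ZMod 2) = 0 <;> simp [h]

theorem theta_mem (i : Fin n) (j : ZMod 2) {v : ExtMod n A} (hv : v ∈ extPart n A j) :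
    theta A i v ∈ extPart n A (j + 1) := by
  intro I hI
  rw [theta_apply]
  split_ifs with h
  · rw [hv _ (fun h' => hI ?_), mul_zero]
    rw [← Finset.card_erase_add_one h]
    push_cast
    rw [h']
  · rfl

theorem del_mem (i : Fin n) (j : ZMod 2) {v : ExtMod n A} (hv : v ∈ extPart n A j) :
    del A i v ∈ extPart n A (j + 1) := by
  intro I hI
  rw [del_apply]
  split_ifs with h
  · rfl
  · rw [hv _ (fun h' => hI ?_), mul_zero]
    rw [Finset.card_insert_of_notMem h] at h'
    push_cast at h'
    rw [← h', add_assoc, (by decide : (1 : ZMod 2) + 1 = 0), add_zero]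

/-- The Koszul matrix factorization `(A[θ₁, …, θₙ], ∑ (a_i θ_i + b_i ∂_i))` of
`w = ∑ a_i b_i`. -/
def koszul (w : A) (a b : Fin n → A) (hw : ∑ i, a i * b i = w) : MatrixFactorization A w where
  carrier := ExtMod n A
  part := extPart n A
  free_part := free_extPart
  isCompl := isCompl_extPart
  d := koszulD a b
  d_mem j v hv := by
    rw [koszulD, LinearMap.sum_apply]
    exact Submodule.sum_mem _ fun i _ => Submodule.add_mem _
      (Submodule.smul_mem _ _ (theta_mem i j hv)) (Submodule.smul_mem _ _ (del_mem i j hv))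
  d_sq v := by
    have := LinearMap.congr_fun (koszulD_mul_self a b) v
    rw [hw] at this
    simpa [Module.End.mul_apply] using this

/-! ### Normally ordered expansion of a linear endomorphism of `A[θ₁, …, θₙ]` -/

/-- The operator `θ_I = θ_{i₁} ⋯ θ_{i_r}` for `I = {i₁ < ⋯ < i_r}`. -/
def thetaOp (A : Type u) [CommRing A] (I : Finset (Fin n)) : Module.End A (ExtMod n A) :=
  ((I.sort (· ≤ ·)).map (theta A)).prod

/-- The operator `∂_J = ∂_{j₁} ⋯ ∂_{j_r}` for `J = {j₁ < ⋯ < j_r}`. -/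
def delOp (A : Type u) [CommRing A] (J : Finset (Fin n)) : Module.End A (ExtMod n A) :=
  ((J.sort (· ≤ ·)).map (del A)).prod

theorem thetaBasis_apply (I K : Finset (Fin n)) :
    thetaBasis A I K = if K = I then 1 else 0 := by
  rw [thetaBasis, Pi.single_apply]

theorem theta_thetaBasis {i : Fin n} {K : Finset (Fin n)} (h : i ∉ K) :
    theta A i (thetaBasis A K) = kSign A i K • thetaBasis A (insert i K) := by
  ext I
  rw [theta_apply, Pi.smul_apply, thetaBasis_apply, thetaBasis_apply, smul_eq_mul]
  by_cases hi : i ∈ I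
  · rw [if_pos hi]
    by_cases h' : I = insert i K
    · subst h'
      simp [h, kSign_insert_of_le]
    · have : I.erase i ≠ K := fun e => h' (by rw [← e, Finset.insert_erase hi])
      simp [h', this]
  · have : I ≠ insert i K := fun e => hi (e ▸ Finset.mem_insert_self i K)
    simp [hi, this]

theorem del_thetaBasis_of_mem {i : Fin n} {K : Finset (Fin n)} (h : i ∈ K) :
    del A i (thetaBasis A K) = kSign A i K • thetaBasis A (K.erase i) := by
  ext I
  rw [del_apply, Pi.smul_apply, thetaBasis_apply, thetaBasis_apply, smul_eq_mul]
  by_cases hi : i ∈ I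
  · have : I ≠ K.erase i := fun e => Finset.notMem_erase i K (e ▸ hi)
    simp [hi, this]
  · rw [if_neg hi]
    by_cases h' : I = K.erase i
    · subst h'
      simp [Finset.insert_erase h, kSign_erase_of_le]
    · have : insert i I ≠ K := fun e => h' (by rw [← e, Finset.erase_insert hi])
      simp [h', this]

theorem del_thetaBasis_of_notMem {i : Fin n} {K : Finset (Fin n)} (h : i ∉ K) :
    del A i (thetaBasis A K) = 0 := by
  ext I
  rw [del_apply, thetaBasis_apply]
  by_cases hi : i ∈ I
  · simp [hi]
  · have : insert i I ≠ K := fun e => h (e ▸ Finset.mem_insert_self i I)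
    simp [this]

theorem thetaOp_thetaBasis_empty (I : Finset (Fin n)) :
    thetaOp A I (thetaBasis A ∅) = thetaBasis A I := by
  have key : ∀ l : List (Fin n), l.Pairwise (· < ·) →
      (l.map (theta A)).prod (thetaBasis A ∅) = thetaBasis A l.toFinset := by
    intro l
    induction l with
    | nil => intro _; simp
    | cons a t ih =>
      intro hl
      rw [List.pairwise_cons] at hl
      have ha : a ∉ t.toFinset := fun h => lt_irrefl _ (hl.1 a (List.mem_toFinset.1 h))
      have hs : kSign A a t.toFinset = 1 := by
        rw [kSign, Finset.filter_eq_empty_iff.2, Finset.card_empty, pow_zero]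
        intro x hx
        exact not_lt.2 (hl.1 x (List.mem_toFinset.1 hx)).le
      rw [List.map_cons, List.prod_cons, Module.End.mul_apply, ih hl.2, theta_thetaBasis ha, hs,
        one_smul, List.toFinset_cons]
  rw [thetaOp, key _ (Finset.sortedLT_sort I).pairwise, Finset.sort_toFinset]

theorem delOp_thetaBasis_of_not_subset {J K : Finset (Fin n)} (h : ¬ J ⊆ K) :
    delOp A J (thetaBasis A K) = 0 := by
  have key : ∀ l : List (Fin n), l.Nodup →
      (¬ l.toFinset ⊆ K → (l.map (del A)).prod (thetaBasis A K) = 0) ∧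
      (∃ u : A, (l.map (del A)).prod (thetaBasis A K) = u • thetaBasis A (K \ l.toFinset)) := by
    intro l
    induction l with
    | nil => intro _; exact ⟨fun h => absurd (by simp) h, 1, by simp⟩
    | cons a t ih =>
      intro hl
      rw [List.nodup_cons] at hl
      obtain ⟨h0, u, hu⟩ := ih hl.2
      rw [List.map_cons, List.prod_cons, Module.End.mul_apply, List.toFinset_cons]
      by_cases ha : a ∈ K
      · have ha' : a ∈ K \ t.toFinset := by simp [ha, hl.1]
        refine ⟨fun h => ?_, u * kSign A a (K \ t.toFinset), ?_⟩
        · rw [h0 fun h' => h (Finset.insert_subset ha h'), map_zero]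
        · rw [hu, map_smul, del_thetaBasis_of_mem ha', smul_smul, Finset.sdiff_insert]
      · have hz : del A a ((t.map (del A)).prod (thetaBasis A K)) = 0 := by
          rw [hu, map_smul, del_thetaBasis_of_notMem (by simp [ha]), smul_zero]
        exact ⟨fun _ => hz, 0, by rw [hz, zero_smul]⟩
  exact (key _ (Finset.sort_nodup J _)).1 (by rwa [Finset.sort_toFinset])

theorem delOp_thetaBasis_self (J : Finset (Fin n)) :
    ∃ u : A, u * u = 1 ∧ delOp A J (thetaBasis A J) = u • thetaBasis A ∅ := by
  have key : ∀ l : List (Fin n), l.Nodup → l.toFinset ⊆ J → ∃ u : A, u * u = 1 ∧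
      (l.map (del A)).prod (thetaBasis A J) = u • thetaBasis A (J \ l.toFinset) := by
    intro l
    induction l with
    | nil => intro _ _; exact ⟨1, by simp, by simp⟩
    | cons a t ih =>
      intro hl hs
      rw [List.nodup_cons] at hl
      rw [List.toFinset_cons, Finset.insert_subset_iff] at hs
      obtain ⟨u, hu1, hu⟩ := ih hl.2 hs.2
      have ha' : a ∈ J \ t.toFinset := by simp [hs.1, hl.1]
      refine ⟨u * kSign A a (J \ t.toFinset), ?_, ?_⟩
      · rw [mul_mul_mul_comm, hu1, kSign_mul_self, one_mul]
      · rw [List.map_cons, List.prod_cons, Module.End.mul_apply, List.toFinset_cons,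
          hu, map_smul, del_thetaBasis_of_mem ha', smul_smul, Finset.sdiff_insert]
  obtain ⟨u, hu1, hu⟩ := key _ (Finset.sort_nodup J (· ≤ ·)) (by rw [Finset.sort_toFinset])
  exact ⟨u, hu1, by rw [delOp, hu, Finset.sort_toFinset, Finset.sdiff_self]⟩

/-- The endomorphism `∑_{I,J} f_{IJ} θ_I ∂_J`. -/
def normalOrdered : (Finset (Fin n) → Finset (Fin n) → A) →ₗ[A] Module.End A (ExtMod n A) where
  toFun f := ∑ I, ∑ J, f I J • (thetaOp A I * delOp A J)
  map_add' f g := by simp [add_smul, Finset.sum_add_distrib]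
  map_smul' c f := by simp [Finset.smul_sum, smul_smul]

theorem ext_thetaBasis {f g : Module.End A (ExtMod n A)}
    (h : ∀ K, f (thetaBasis A K) = g (thetaBasis A K)) : f = g :=
  (Pi.basisFun A (Finset (Fin n))).ext fun K => by
    rw [Pi.basisFun_apply]; exact h K

theorem sum_smul_thetaBasis (v : ExtMod n A) : ∑ I, v I • thetaBasis A I = v := by
  ext K
  simp [thetaBasis_apply]

theorem normalOrdered_surjective :
    Function.Surjective (normalOrdered : _ →ₗ[A] Module.End A (ExtMod n A)) := by
  choose u hu1 hu using fun J : Finset (Fin n) => delOp_thetaBasis_self (A := A) J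
  have key : ∀ m d : ℕ, d + m = n + 1 → ∀ M : Module.End A (ExtMod n A),
      (∀ K, K.card < d → M (thetaBasis A K) = 0) → ∃ f, normalOrdered f = M := by
    intro m
    induction m with
    | zero =>
      intro d hd M hM
      refine ⟨0, (map_zero _).trans (ext_thetaBasis fun K => ?_)⟩
      have := Finset.card_le_univ K
      rw [Fintype.card_fin] at this
      rw [hM K (by omega), LinearMap.zero_apply]
    | succ m ih =>
      intro d hd M hM
      let f : Finset (Fin n) → Finset (Fin n) → A :=
        fun I J => if J.card = d then u J * M (thetaBasis A J) I else 0
      suffices hkill : ∀ K, K.card < d + 1 → (M - normalOrdered f) (thetaBasis A K) = 0 by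
        obtain ⟨f', hf'⟩ := ih (d + 1) (by omega) (M - normalOrdered f) hkill
        exact ⟨f' + f, by rw [map_add, hf', sub_add_cancel]⟩
      intro K hK
      · have hz : ∀ I J, J ≠ K → (f I J • (thetaOp A I * delOp A J)) (thetaBasis A K) = 0 := by
          intro I J hJ
          by_cases hd : J.card = d
          · have : ¬ J ⊆ K := fun hs => hJ (Finset.eq_of_subset_of_card_le hs (by omega))
            rw [LinearMap.smul_apply, Module.End.mul_apply, delOp_thetaBasis_of_not_subset this,
              map_zero, smul_zero]
          · simp [f, hd]
        have hN : normalOrdered f (thetaBasis A K)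
            = ∑ I, f I K • u K • thetaBasis A I := by
          change (∑ I, ∑ J, f I J • (thetaOp A I * delOp A J)) (thetaBasis A K) = _
          rw [LinearMap.sum_apply]
          refine Finset.sum_congr rfl fun I _ => ?_
          rw [LinearMap.sum_apply, Finset.sum_eq_single K (fun J _ hJ => hz I J hJ) (by simp),
            LinearMap.smul_apply, Module.End.mul_apply, hu, map_smul, thetaOp_thetaBasis_empty]
        rw [LinearMap.sub_apply, hN]
        by_cases hd : K.card = d
        · rw [sub_eq_zero]
          conv_lhs => rw [← sum_smul_thetaBasis (M (thetaBasis A K))]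
          refine Finset.sum_congr rfl fun I _ => ?_
          rw [smul_smul]
          congr 1
          simp only [f, if_pos hd]
          rw [mul_right_comm, hu1, one_mul]
        · rw [hM K (by omega)]
          simp [f, hd]
  intro M
  exact key (n + 1) 0 (by omega) M (fun K hK => absurd hK (by omega))

theorem normalOrdered_bijective :
    Function.Bijective (normalOrdered : _ →ₗ[A] Module.End A (ExtMod n A)) := by
  refine ⟨?_, normalOrdered_surjective⟩
  let e : Module.End A (ExtMod n A) ≃ₗ[A] (Finset (Fin n) → Finset (Fin n) → A) :=
    LinearMap.toMatrix'
  have h := OrzechProperty.injective_of_surjective_endomorphism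
    (e.toLinearMap ∘ₗ (normalOrdered : _ →ₗ[A] Module.End A (ExtMod n A)))
    (by rw [LinearMap.coe_comp]; exact e.surjective.comp normalOrdered_surjective)
  rw [LinearMap.coe_comp] at h
  exact h.of_comp

/-- The coefficient `f_{IJ}` of `θ_I ∂_J` in the unique expansion `φ = ∑ f_{IJ} θ_I ∂_J`. -/
def coeff (I J : Finset (Fin n)) (φ : ExtMod n A →ₗ[A] ExtMod n A) : A :=
  (LinearEquiv.ofBijective normalOrdered normalOrdered_bijective).symm φ I J

theorem eq_sum_coeff (φ : ExtMod n A →ₗ[A] ExtMod n A) :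
    φ = ∑ I, ∑ J, coeff I J φ • (thetaOp A I * delOp A J) :=
  ((LinearEquiv.ofBijective normalOrdered normalOrdered_bijective).apply_symm_apply φ).symm

/-- The coefficient of `θ_I = θ_I ∂_∅` in `φ` is the `θ_I`-component of `φ(1)`. -/
theorem coeff_empty (I : Finset (Fin n)) (φ : ExtMod n A →ₗ[A] ExtMod n A) :
    coeff I ∅ φ = φ (thetaBasis A ∅) I := by
  conv_rhs => rw [eq_sum_coeff φ]
  have h : (∑ I, ∑ J, coeff I J φ • (thetaOp A I * delOp A J)) (thetaBasis A ∅)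
      = ∑ I, coeff I ∅ φ • thetaBasis A I := by
    rw [LinearMap.sum_apply]
    refine Finset.sum_congr rfl fun K _ => ?_
    rw [LinearMap.sum_apply, Finset.sum_eq_single ∅]
    · simp [delOp, thetaOp_thetaBasis_empty]
    · intro J _ hJ
      rw [LinearMap.smul_apply, Module.End.mul_apply,
        delOp_thetaBasis_of_not_subset (by simpa using hJ), map_zero, smul_zero]
    · simp
  rw [h, sum_smul_thetaBasis (fun I => coeff I ∅ φ)]

end Koszul

/-! ### The twisted diagonal matrix factorizations -/

section TwistedDiagonal

variable {k : Type u} [Field k] {n : ℕ}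

/-- `S = k[x₁, …, xₙ, y₁, …, yₙ]`; `inl` indexes the `x`- and `inr` the `y`-variables. -/
abbrev DoubleRing (k : Type u) [Field k] (n : ℕ) : Type u := MvPolynomial (Fin n ⊕ Fin n) k

/-- `x_i ∈ S`. -/
def xv (k : Type u) [Field k] {n : ℕ} (i : Fin n) : DoubleRing k n := X (Sum.inl i)

/-- `y_i ∈ S`. -/
def yv (k : Type u) [Field k] {n : ℕ} (i : Fin n) : DoubleRing k n := X (Sum.inr i)

/-- `W(y) - W(x) ∈ S`. -/
def boxMinus (W : MvPolynomial (Fin n) k) : DoubleRing k n := aeval (yv k) W - aeval (xv k) W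

/-- `W(y₁, …, y_m, x_{m+1}, …, xₙ) ∈ S`. -/
def mixed (W : MvPolynomial (Fin n) k) (m : ℕ) : DoubleRing k n :=
  aeval (fun i : Fin n => if (i : ℕ) < m then yv k i else xv k i) W

theorem sub_dvd_mixed (W : MvPolynomial (Fin n) k) (j : Fin n) :
    yv k j - xv k j ∣ mixed W (j + 1) - mixed W j := by
  rw [← Ideal.mem_span_singleton, ← Ideal.Quotient.eq_zero_iff_mem, map_sub, sub_eq_zero]
  let q := Ideal.Quotient.mkₐ k (Ideal.span {yv k j - xv k j})
  have hq : q (yv k j) = q (xv k j) := by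
    rw [← sub_eq_zero, ← map_sub]
    exact Ideal.Quotient.eq_zero_iff_mem.2 (Ideal.mem_span_singleton_self _)
  change q (mixed W (j + 1)) = q (mixed W j)
  rw [mixed, mixed, ← AlgHom.comp_apply, ← AlgHom.comp_apply]
  congr 1
  ext i
  simp only [AlgHom.comp_apply, aeval_X]
  rcases lt_trichotomy (i : ℕ) j with h | h | h
  · rw [if_pos (by omega), if_pos h]
  · obtain rfl := Fin.ext h
    rw [if_pos (by omega), if_neg (by omega), hq]
  · rw [if_neg (by omega), if_neg (by omega)]

/-- The difference quotient `∇_j W ∈ S`,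
`(W(y₁, …, y_j, x_{j+1}, …, xₙ) - W(y₁, …, y_{j-1}, x_j, …, xₙ)) / (y_j - x_j)`. -/
def nabla (W : MvPolynomial (Fin n) k) (j : Fin n) : DoubleRing k n :=
  (sub_dvd_mixed W j).choose

theorem sub_mul_nabla (W : MvPolynomial (Fin n) k) (j : Fin n) :
    (yv k j - xv k j) * nabla W j = mixed W (j + 1) - mixed W j :=
  (sub_dvd_mixed W j).choose_spec.symm

theorem sum_sub_mul_nabla (W : MvPolynomial (Fin n) k) :
    ∑ j, (yv k j - xv k j) * nabla W j = boxMinus W := by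
  simp only [sub_mul_nabla]
  rw [Fin.sum_univ_eq_sum_range (fun m => mixed W (m + 1) - mixed W m), Finset.sum_range_sub,
    boxMinus, mixed, mixed]
  simp

/-- The substitution `r(x, y) ↦ r(a x, b y)` for diagonal `a, b`. -/
def scale (a b : Fin n → kˣ) : DoubleRing k n →ₐ[k] DoubleRing k n :=
  aeval (Sum.elim (fun i => C (a i : k) * xv k i) (fun i => C (b i : k) * yv k i))

theorem scale_xv (a b : Fin n → kˣ) (i : Fin n) : scale a b (xv k i) = C (a i : k) * xv k i := by
  rw [scale, xv, aeval_X]; rfl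

theorem scale_yv (a b : Fin n → kˣ) (i : Fin n) : scale a b (yv k i) = C (b i : k) * yv k i := by
  rw [scale, yv, aeval_X]; rfl

theorem scale_C (a b : Fin n → kˣ) (c : k) : scale a b (C c) = C c := by
  rw [scale, aeval_C]; rfl

theorem scale_scale (a b a' b' : Fin n → kˣ) (r : DoubleRing k n) :
    scale a b (scale a' b' r) = scale (a * a') (b * b') r := by
  rw [← AlgHom.comp_apply]
  congr 1
  ext i : 1
  rcases i with i | i
  · change scale a b (scale a' b' (xv k i)) = scale _ _ (xv k i)
    simp only [scale_xv, map_mul, scale_C, Pi.mul_apply, Units.val_mul]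
    ring
  · change scale a b (scale a' b' (yv k i)) = scale _ _ (yv k i)
    simp only [scale_yv, map_mul, scale_C, Pi.mul_apply, Units.val_mul]
    ring

theorem scale_one (r : DoubleRing k n) : scale (1 : Fin n → kˣ) 1 r = r := by
  have : scale (1 : Fin n → kˣ) 1 = AlgHom.id k (DoubleRing k n) := by
    ext i : 1
    rcases i with i | i
    · change scale _ _ (xv k i) = xv k i
      simp [scale_xv]
    · change scale _ _ (yv k i) = yv k i
      simp [scale_yv]
  rw [this]; rfl

/-- `W` is invariant under the diagonal transformation `x_i ↦ a_i x_i`. -/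
def IsInvariant (W : MvPolynomial (Fin n) k) (a : Fin n → kˣ) : Prop :=
  aeval (fun i => C (a i : k) * X i) W = W

theorem scale_boxMinus {W : MvPolynomial (Fin n) k} {a : Fin n → kˣ} (h : IsInvariant W a) :
    scale a 1 (boxMinus W) = boxMinus W := by
  rw [boxMinus, map_sub]
  congr 1
  · rw [← AlgHom.comp_apply]
    congr 1
    ext i
    simp [scale_yv]
  · conv_rhs => rw [← h]
    rw [← AlgHom.comp_apply, ← AlgHom.comp_apply]
    congr 1
    ext i
    simp [scale_xv]

/-- `y_i - a_i x_i`. -/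
def twX (a : Fin n → kˣ) (i : Fin n) : DoubleRing k n := yv k i - C (a i : k) * xv k i

/-- `∇_i W(a x, y)`. -/
def twNabla (W : MvPolynomial (Fin n) k) (a : Fin n → kˣ) (i : Fin n) : DoubleRing k n :=
  scale a 1 (nabla W i)

theorem sum_twX_mul_twNabla {W : MvPolynomial (Fin n) k} {a : Fin n → kˣ} (h : IsInvariant W a) :
    ∑ i, twX a i * twNabla W a i = boxMinus W := by
  conv_rhs => rw [← scale_boxMinus h, ← sum_sub_mul_nabla, map_sum]
  refine Finset.sum_congr rfl fun i _ => ?_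
  rw [map_mul, map_sub, scale_xv, scale_yv, twX, twNabla]
  simp

variable {G : Type*} [CommGroup G]

/-- The matrix factorization
`Δ_g = (S[θ₁, …, θₙ], ∑ ((y_i - g x_i) θ_i + ∇_i W(g x, y) ∂_i))` of `W(y) - W(x)`. The diagonal
action of `G` is given by the character vector `χ`, that is `g · x_i = χ g i * x_i`. -/
def Delta (W : MvPolynomial (Fin n) k) (χ : G →* (Fin n → kˣ)) (hW : ∀ g, IsInvariant W (χ g))
    (g : G) : MatrixFactorization (DoubleRing k n) (boxMinus W) :=
  koszul (boxMinus W) (twX (χ g)) (twNabla W (χ g)) (sum_twX_mul_twNabla (hW g))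

/-- The index set `I_g` of the variables moved by `g`. -/
def movedSet (χ : G →* (Fin n → kˣ)) (g : G) : Finset (Fin n) :=
  open Classical in Finset.univ.filter fun i => χ g i ≠ 1

/-- The action `(1 × b) · (r(x, y) θ_I) = r(x, b y) ρ(b) θ_I`, where `ρ(b) θ_i = b_i⁻¹ θ_i`, on
`S[θ₁, …, θₙ]`. -/
def act (b : Fin n → kˣ) : ExtMod n (DoubleRing k n) →+ ExtMod n (DoubleRing k n) where
  toFun v I := C ((∏ i ∈ I, (b i)⁻¹ : kˣ) : k) * scale 1 b (v I)
  map_zero' := by ext I; simp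
  map_add' v v' := by ext I : 1; simp [mul_add]

theorem act_apply (b : Fin n → kˣ) (v : ExtMod n (DoubleRing k n)) (I : Finset (Fin n)) :
    act b v I = C ((∏ i ∈ I, (b i)⁻¹ : kˣ) : k) * scale 1 b (v I) := rfl

theorem act_smul (b : Fin n → kˣ) (r : DoubleRing k n) (v : ExtMod n (DoubleRing k n)) :
    act b (r • v) = scale 1 b r • act b v := by
  ext I : 1
  simp only [act_apply, Pi.smul_apply, smul_eq_mul, map_mul]
  ring

theorem act_act (b b' : Fin n → kˣ) (v : ExtMod n (DoubleRing k n)) :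
    act b (act b' v) = act (b * b') v := by
  ext I : 1
  simp only [act_apply, map_mul, scale_C, scale_scale, one_mul, Pi.mul_apply, mul_inv,
    Finset.prod_mul_distrib, Units.val_mul]
  ring

theorem act_one (v : ExtMod n (DoubleRing k n)) : act (1 : Fin n → kˣ) v = v := by
  ext I : 1
  simp [act_apply, scale_one]

theorem act_theta (b : Fin n → kˣ) (i : Fin n) (v : ExtMod n (DoubleRing k n)) :
    act b (theta _ i v) = (C (((b i)⁻¹ : kˣ) : k) : DoubleRing k n) • theta _ i (act b v) := by
  ext I : 1
  simp only [act_apply, theta_apply, Pi.smul_apply, smul_eq_mul]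
  split_ifs with h
  · rw [← Finset.mul_prod_erase I _ h]
    simp only [kSign, map_mul, map_pow, map_neg, map_one, Units.val_mul]
    ring
  · simp

theorem act_del (b : Fin n → kˣ) (i : Fin n) (v : ExtMod n (DoubleRing k n)) :
    act b (del _ i v) = (C (b i : k) : DoubleRing k n) • del _ i (act b v) := by
  ext I : 1
  simp only [act_apply, del_apply, Pi.smul_apply, smul_eq_mul]
  split_ifs with h
  · simp
  · rw [Finset.prod_insert h]
    have hb : (C (b i : k) * C (((b i)⁻¹ : kˣ) : k) : DoubleRing k n) = 1 := by
      rw [← C_mul, Units.mul_inv, C_1]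
    simp only [kSign, map_mul, map_pow, map_neg, map_one, Units.val_mul]
    linear_combination (-(C ((∏ i ∈ I, (b i)⁻¹ : kˣ) : k)) * (-1) ^ (I.filter (· < i)).card
      * scale 1 b (v (insert i I))) * hb

theorem act_sgn (W : MvPolynomial (Fin n) k) (χ : G →* (Fin n → kˣ))
    (hW : ∀ g, IsInvariant W (χ g)) (g g' : G) (b : Fin n → kˣ)
    (v : ExtMod n (DoubleRing k n)) :
    act b ((Delta W χ hW g).sgn v) = (Delta W χ hW g').sgn (act b v) := by
  have hmem : ∀ j, ∀ v ∈ extPart n (DoubleRing k n) j, act b v ∈ extPart n _ j := by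
    intro j v hv I hI
    rw [act_apply, hv I hI, map_zero, mul_zero]
  have hv : v ∈ extPart n (DoubleRing k n) 0 ⊔ extPart n (DoubleRing k n) 1 := by
    rw [isCompl_extPart.sup_eq_top]; trivial
  obtain ⟨v0, h0, v1, h1, rfl⟩ := Submodule.mem_sup.1 hv
  have e0 : (Delta W χ hW g).sgn v0 = v0 := MatrixFactorization.sgn_of_mem_zero _ h0
  have e1 : (Delta W χ hW g).sgn v1 = -v1 := MatrixFactorization.sgn_of_mem_one _ h1
  have e0' : (Delta W χ hW g').sgn (act b v0) = act b v0 :=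
    MatrixFactorization.sgn_of_mem_zero _ (hmem 0 _ h0)
  have e1' : (Delta W χ hW g').sgn (act b v1) = -act b v1 :=
    MatrixFactorization.sgn_of_mem_one _ (hmem 1 _ h1)
  have s1 : (Delta W χ hW g).sgn (v0 + v1) = (v0 + -v1 : ExtMod n (DoubleRing k n)) :=
    ((Delta W χ hW g).sgn.map_add v0 v1).trans
      (congrArg₂ (fun a b : ExtMod n (DoubleRing k n) => a + b) e0 e1)
  have s2 : (Delta W χ hW g').sgn (act b v0 + act b v1)
      = (act b v0 + -act b v1 : ExtMod n (DoubleRing k n)) :=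
    ((Delta W χ hW g').sgn.map_add (act b v0) (act b v1)).trans
      (congrArg₂ (fun a b : ExtMod n (DoubleRing k n) => a + b) e0' e1')
  refine (congrArg (act b) s1).trans ?_
  rw [map_add, map_neg, map_add (act b) v0 v1]
  exact s2.symm

theorem scale_mixed {W : MvPolynomial (Fin n) k} {b : Fin n → kˣ} (h : IsInvariant W b)
    (m : ℕ) : scale 1 b (mixed W m) = scale b⁻¹ 1 (mixed W m) := by
  conv_rhs => rw [mixed, ← h]
  rw [mixed, ← AlgHom.comp_apply, ← AlgHom.comp_apply, ← AlgHom.comp_apply]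
  congr 1
  ext i : 1
  simp only [AlgHom.comp_apply, aeval_X, map_mul, aeval_C]
  have hC : ∀ c : k, algebraMap k (DoubleRing k n) c = C c := fun _ => rfl
  have hb : (C (b i : k) * C (((b i)⁻¹ : kˣ) : k) : DoubleRing k n) = 1 := by
    rw [← C_mul, Units.mul_inv, C_1]
  split_ifs
  · simp [scale_yv]
  · simp only [hC, scale_xv, scale_C, Pi.one_apply, Units.val_one, C_1, one_mul, Pi.inv_apply]
    rw [← mul_assoc, hb, one_mul]

theorem twX_ne_zero (a : Fin n → kˣ) (i : Fin n) : twX a i ≠ (0 : DoubleRing k n) := by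
  intro h
  have := congrArg (aeval (Sum.elim (fun _ => 0) (fun _ => 1) : Fin n ⊕ Fin n → k)) h
  simp [twX, xv, yv] at this

theorem scale_twX (a b : Fin n → kˣ) (i : Fin n) :
    scale 1 b (twX a i) = C (b i : k) * twX (a * b⁻¹) i := by
  have hb : (C (b i : k) * C (((b i)⁻¹ : kˣ) : k) : DoubleRing k n) = 1 := by
    rw [← C_mul, Units.mul_inv, C_1]
  simp only [twX, map_sub, map_mul, scale_xv, scale_yv, scale_C, Pi.one_apply, Units.val_one, C_1,
    one_mul, Pi.mul_apply, Pi.inv_apply, Units.val_mul]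
  linear_combination (C (a i : k) * xv k i) * hb

theorem scale_twNabla {W : MvPolynomial (Fin n) k} {b : Fin n → kˣ} (h : IsInvariant W b)
    (a : Fin n → kˣ) (i : Fin n) :
    C (b i : k) * scale 1 b (twNabla W a i) = twNabla W (a * b⁻¹) i := by
  have e : ∀ c : Fin n → kˣ, twX c i * twNabla W c i
      = scale c 1 (mixed W (i + 1) - mixed W i) := by
    intro c
    rw [← sub_mul_nabla, map_mul, map_sub, scale_xv, scale_yv, twX, twNabla]
    simp
  apply mul_left_cancel₀ (twX_ne_zero (a * b⁻¹) i)
  rw [e, ← mul_assoc, mul_comm (twX _ i), ← scale_twX, ← map_mul, e, scale_scale, map_sub, map_sub]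
  have key : ∀ m, scale (1 * a) (b * 1) (mixed W m) = scale (a * b⁻¹) 1 (mixed W m) := by
    intro m
    have h1 : scale (1 * a) (b * 1) (mixed W m) = scale a 1 (scale 1 b (mixed W m)) := by
      rw [scale_scale]; simp
    rw [h1, scale_mixed h, scale_scale, mul_one]
  rw [key, key]

/-- The action intertwines the differentials of `Δ_g` and `Δ_{g b⁻¹}`. -/
theorem act_koszulD {W : MvPolynomial (Fin n) k} {b : Fin n → kˣ} (h : IsInvariant W b)
    (a : Fin n → kˣ) (v : ExtMod n (DoubleRing k n)) :
    act b (koszulD (twX a) (twNabla W a) v)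
      = koszulD (twX (a * b⁻¹)) (twNabla W (a * b⁻¹)) (act b v) := by
  have hb : ∀ i, (C (b i : k) * C (((b i)⁻¹ : kˣ) : k) : DoubleRing k n) = 1 := fun i => by
    rw [← C_mul, Units.mul_inv, C_1]
  simp only [koszulD, LinearMap.sum_apply, map_sum, LinearMap.add_apply, LinearMap.smul_apply,
    map_add, act_smul, act_theta, act_del, smul_smul]
  refine Finset.sum_congr rfl fun i _ => ?_
  congr 2
  · rw [scale_twX, mul_right_comm, hb, one_mul]
  · rw [← scale_twNabla h, mul_comm]

/-! ### The product -/

variable (W : MvPolynomial (Fin n) k) (χ : G →* (Fin n → kˣ)) (hW : ∀ g, IsInvariant W (χ g))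

/-- `h_* φ : Δ_h → Δ_{g h}` for `φ : Δ_1 → Δ_g`, that is
`(h_* φ)(r(x, y) θ_I) = r(x, y) · (1 × h⁻¹) · φ(ρ(h) θ_I)`; see `push_apply_theta`. -/
def push {g : G} (h : G) (φ : MatrixFactorization.hom (Delta W χ hW 1) (Delta W χ hW g)) :
    MatrixFactorization.hom (Delta W χ hW h) (Delta W χ hW (g * h)) :=
  let φ' : ExtMod n (DoubleRing k n) →ₗ[DoubleRing k n] ExtMod n (DoubleRing k n) := φ
  let f : ExtMod n (DoubleRing k n) →ₗ[DoubleRing k n] ExtMod n (DoubleRing k n) :=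
    { toFun := fun v => act (χ h⁻¹) (φ' (act (χ h) v))
      map_add' := fun v v' => by simp only [map_add]
      map_smul' := fun r v => by
        rw [act_smul, map_smul, act_smul, scale_scale, ← map_mul χ, inv_mul_cancel, map_one,
          mul_one, scale_one, RingHom.id_apply] }
  f

theorem push_apply {g : G} (h : G)
    (φ : MatrixFactorization.hom (Delta W χ hW 1) (Delta W χ hW g))
    (v : ExtMod n (DoubleRing k n)) :
    push W χ hW h φ v = act (χ h⁻¹) (φ (act (χ h) v)) := rfl

theorem push_apply_theta {g : G} (h : G)
    (φ : MatrixFactorization.hom (Delta W χ hW 1) (Delta W χ hW g)) (r : DoubleRing k n)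
    (I : Finset (Fin n)) :
    push W χ hW h φ (r • thetaBasis _ I : ExtMod n (DoubleRing k n))
      = (r • act (χ h⁻¹) (φ ((C ((∏ i ∈ I, (χ h i)⁻¹ : kˣ) : k) : DoubleRing k n) • thetaBasis (DoubleRing k n) I :
          ExtMod n (DoubleRing k n))) : ExtMod n (DoubleRing k n)) := by
  have e : act (χ h) (thetaBasis (DoubleRing k n) I)
      = (C ((∏ i ∈ I, (χ h i)⁻¹ : kˣ) : k) : DoubleRing k n) • thetaBasis (DoubleRing k n) I := by
    ext K : 1
    rw [act_apply, Pi.smul_apply, thetaBasis_apply]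
    split_ifs with hK
    · subst hK; simp
    · simp
  refine (LinearMap.map_smul (push W χ hW h φ) r _).trans ?_
  rw [push_apply, e]
  rfl

theorem D_push {g : G} (h : G)
    (φ : MatrixFactorization.hom (Delta W χ hW 1) (Delta W χ hW g)) :
    MatrixFactorization.D _ _ (push W χ hW h φ)
      = push W χ hW h (MatrixFactorization.D _ _ φ) := by
  have hd1 : ∀ v : ExtMod n (DoubleRing k n),
      act (χ h) ((Delta W χ hW h).d v) = (Delta W χ hW 1).d (act (χ h) v) := by
    intro v
    refine (act_koszulD (hW h) (χ h) v).trans ?_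
    rw [mul_inv_cancel, ← map_one χ]
    rfl
  have hd2 : ∀ v : ExtMod n (DoubleRing k n),
      act (χ h⁻¹) ((Delta W χ hW g).d v) = (Delta W χ hW (g * h)).d (act (χ h⁻¹) v) := by
    intro v
    refine (act_koszulD (hW h⁻¹) (χ g) v).trans ?_
    rw [← map_inv, inv_inv, ← map_mul]
    rfl
  refine LinearMap.ext fun v => ?_
  have e1 := MatrixFactorization.D_apply (push W χ hW h φ) v
  have e2 := MatrixFactorization.D_apply φ (act (χ h) v)
  refine e1.trans (Eq.trans ?_ (congrArg (act (χ h⁻¹)) e2).symm)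
  refine Eq.trans ?_ (map_sub (act (χ h⁻¹)) _ _).symm
  have h3 : act (χ h) ((Delta W χ hW h).sgn ((Delta W χ hW h).d v))
      = (Delta W χ hW 1).sgn ((Delta W χ hW 1).d (act (χ h) v)) :=
    (act_sgn W χ hW h 1 (χ h) _).trans (congrArg (Delta W χ hW 1).sgn (hd1 v))
  have h4 := (act_sgn W χ hW g (g * h) (χ h⁻¹)
    (φ (act (χ h) ((Delta W χ hW h).sgn ((Delta W χ hW h).d v))))).symm
  have h5 := congrArg (fun z => act (χ h⁻¹) ((Delta W χ hW g).sgn (φ z))) h3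
  exact congrArg₂ (fun a b : ExtMod n (DoubleRing k n) => a - b) (hd2 _).symm (h4.trans h5)

/-- The product `φ ∪ ψ = (h_* φ) ∘ ψ : Δ_1 → Δ_{g h}` of `φ : Δ_1 → Δ_g` and `ψ : Δ_1 → Δ_h`. -/
def cup {g h : G} (φ : MatrixFactorization.hom (Delta W χ hW 1) (Delta W χ hW g))
    (ψ : MatrixFactorization.hom (Delta W χ hW 1) (Delta W χ hW h)) :
    MatrixFactorization.hom (Delta W χ hW 1) (Delta W χ hW (g * h)) :=
  push W χ hW h φ ∘ₗ ψ

theorem push_sub {g : G} (h : G)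
    (φ φ' : MatrixFactorization.hom (Delta W χ hW 1) (Delta W χ hW g)) :
    push W χ hW h (φ - φ') = push W χ hW h φ - push W χ hW h φ' :=
  LinearMap.ext fun v => map_sub (act (χ h⁻¹)) (φ (act (χ h) v)) (φ' (act (χ h) v))

theorem push_zero {g : G} (h : G) : push (g := g) W χ hW h 0 = 0 :=
  LinearMap.ext fun _ => map_zero (act (χ h⁻¹))

open MatrixFactorization

variable {W χ hW}

theorem isClosed_push {g : G} (h : G) {φ : hom (Delta W χ hW 1) (Delta W χ hW g)}
    (hφ : IsClosed φ) : IsClosed (push W χ hW h φ) := by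
  unfold MatrixFactorization.IsClosed at *
  rw [D_push, hφ, push_zero]

theorem isNullhomotopic_push {g : G} (h : G) {φ : hom (Delta W χ hW 1) (Delta W χ hW g)}
    (hφ : IsNullhomotopic φ) : IsNullhomotopic (push W χ hW h φ) := by
  obtain ⟨s, rfl⟩ := hφ
  exact ⟨push W χ hW h s, D_push W χ hW h s⟩

theorem isClosed_cup {g h : G} {φ : hom (Delta W χ hW 1) (Delta W χ hW g)}
    {ψ : hom (Delta W χ hW 1) (Delta W χ hW h)} (hφ : IsClosed φ) (hψ : IsClosed ψ) :
    IsClosed (cup W χ hW φ ψ) :=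
  MatrixFactorization.IsClosed.comp (isClosed_push h hφ) hψ

theorem isNullhomotopic_cup_sub {g h : G} {φ φ' : hom (Delta W χ hW 1) (Delta W χ hW g)}
    {ψ ψ' : hom (Delta W χ hW 1) (Delta W χ hW h)} (hφ' : IsClosed φ')
    (hψ : IsClosed ψ) (hφφ' : IsNullhomotopic (φ - φ')) (hψψ' : IsNullhomotopic (ψ - ψ')) :
    IsNullhomotopic (cup W χ hW φ ψ - cup W χ hW φ' ψ') := by
  obtain ⟨s, hs⟩ := MatrixFactorization.IsNullhomotopic.comp_right
    (isNullhomotopic_push h hφφ') hψ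
  obtain ⟨t, ht⟩ := MatrixFactorization.IsNullhomotopic.comp_left (isClosed_push h hφ') hψψ'
  refine ⟨s + t, ?_⟩
  rw [map_add, hs, ht, push_sub, LinearMap.sub_comp, LinearMap.comp_sub, cup, cup]
  exact sub_add_sub_cancel _ _ _

/-- The product `∪ : Hom(Δ_1, Δ_g) × Hom(Δ_1, Δ_h) → Hom(Δ_1, Δ_{g h})` on cohomology. -/
def cupHom {g h : G} (a : Hom (Delta W χ hW 1) (Delta W χ hW g))
    (b : Hom (Delta W χ hW 1) (Delta W χ hW h)) :
    Hom (Delta W χ hW 1) (Delta W χ hW (g * h)) :=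
  Quotient.map₂
    (sa := (boundaries (Delta W χ hW 1) (Delta W χ hW g)).quotientRel)
    (sb := (boundaries (Delta W χ hW 1) (Delta W χ hW h)).quotientRel)
    (sc := (boundaries (Delta W χ hW 1) (Delta W χ hW (g * h))).quotientRel)
    (fun φ ψ => ⟨cup W χ hW φ.1 ψ.1, isClosed_cup φ.2 ψ.2⟩)
    (fun φ φ' hφ ψ ψ' hψ => by
      rw [← Quotient.eq_iff_equiv] at *
      exact (cls_eq_cls _ _).2 (isNullhomotopic_cup_sub φ'.2 ψ.2 ((cls_eq_cls φ.2 φ'.2).1 hφ)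
        ((cls_eq_cls ψ.2 ψ'.2).1 hψ))) a b

theorem cupHom_cls {g h : G} {φ : hom (Delta W χ hW 1) (Delta W χ hW g)}
    {ψ : hom (Delta W χ hW 1) (Delta W χ hW h)} (hφ : IsClosed φ) (hψ : IsClosed ψ) :
    cupHom (cls φ hφ) (cls ψ hψ) = cls (cup W χ hW φ ψ) (isClosed_cup hφ hψ) := rfl

variable (W) in
/-- The Jacobian algebra `k[x₁, …, xₙ] / (∂W/∂x₁, …, ∂W/∂xₙ)`. -/
abbrev Jac : Type u := MvPolynomial (Fin n) k ⧸ Ideal.span (Set.range fun i => pderiv i W)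

/-- The coefficient of `θ_{I_g}` in a morphism `Δ_1 → Δ_g`. -/
def leadingCoeff {g : G} (φ : hom (Delta W χ hW 1) (Delta W χ hW g)) : DoubleRing k n :=
  coeff (movedSet χ g) ∅ φ

end TwistedDiagonal

end

end TwistedMF

/-! Write `L_x φ = xφ` and `R_x φ = (-1)^{|φ|} φx`. On `hom(Δ_1, Δ_h)`, which is the space of
endomorphisms of `S[θ]`, the differential is a combination of `L_{θ_i}`, `L_{∂_i}`, `R_{θ_i}` and
`R_{∂_i}`. With `H = I_h`, these terms regroup into `2n` pairs of creation operators `E_t` and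
annihilation operators `ι_t` with `[ι_s, ι_t] = 0` and `[ι_s, E_t] = δ_{st}` (anticommutators). The
operator `θ_H` is killed by every `ι_t`, and the coefficient of `θ_H` vanishes on the image of every
`E_t`. Iterated annihilation therefore gives coordinates that identify the morphism complex with a
Koszul module on `2n` odd variables with differential `∑ (a_t θ_t + b_t ∂_t)`, where `∑ a_t b_t = 0`
and the coefficient of `θ_H` becomes the constant term (`exists_sum_apply_eq`).

The `b_t` are `y_i - x_i` for all `i`, `(1 - h_i) x_i` for `i ∈ H`, and `∇_i W(hx, y)` for `i ∉ H`.
Modulo them `y = x = hx`, the difference quotients become partial derivatives, and invariance makes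
the remaining partial derivatives vanish too. So `S/(b)` is a quotient of `Jac(W)`, hence finite
dimensional (`finite_quotient_of_finite_jac`).

Thus `(b)` contains a monic polynomial in each of the `2n` variables. These form a regular family,
and depth sensitivity makes the Koszul complex of `b` exact in positive degrees
(`exists_contraction_eq`). Removing the components of a cycle degree by degree shows that a cycle
with zero constant term is a boundary (`exists_koszulD_eq`). This is claim 1; the other claims
follow by linearity and because the product is well defined on cohomology. -/

namespace TwistedMF

/-! ### Exactness of Koszul complexes -/

section KoszulExact

variable {n : ℕ} {A : Type u} [CommRing A]

/-- The part of `A[θ₁, …, θₙ]` spanned by the `θ_I` with `|I| = d`. -/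
def IsHomogeneousOfDegree (d : ℕ) (v : ExtMod n A) : Prop :=
  ∀ I : Finset (Fin n), I.card ≠ d → v I = 0

/-- The multiplication by `∑ c_i θ_i`. -/
noncomputable def wedge (c : Fin n → A) : Module.End A (ExtMod n A) := ∑ i, c i • theta A i

/-- The contraction `∑ b_i ∂_i`. -/
noncomputable def contraction (b : Fin n → A) : Module.End A (ExtMod n A) := ∑ i, b i • del A i

theorem koszulD_eq_wedge_add_contraction (a b : Fin n → A) :
    koszulD a b = wedge a + contraction b := Finset.sum_add_distrib

/-- These are the cross terms of the square of `wedge c + contraction b`, both pure squares being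
zero. Hence `wedge c` is a homotopy for multiplication by any element `∑ c_i b_i` of the ideal of
`b`. -/
theorem contraction_mul_wedge (b c : Fin n → A) :
    contraction b * wedge c + wedge c * contraction b
      = (∑ i, c i * b i) • (1 : Module.End A (ExtMod n A)) := by
  have hT : wedge c * wedge c = 0 :=
    sum_smul_mul_self Finset.univ c (theta A) theta_mul_self fun i j h => theta_anticomm h
  have hB : contraction b * contraction b = 0 :=
    sum_smul_mul_self Finset.univ b (del A) del_mul_self fun i j h => del_anticomm h
  have h : (wedge c + contraction b) * (wedge c + contraction b)
      = (∑ i, c i * b i) • (1 : Module.End A (ExtMod n A)) := by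
    rw [← koszulD_eq_wedge_add_contraction]
    exact koszulD_mul_self c b
  rw [← h, mul_add, add_mul, add_mul, hT, hB]
  abel

theorem wedge_apply (c : Fin n → A) (v : ExtMod n A) (I : Finset (Fin n)) :
    wedge c v I = ∑ i, c i * theta A i v I := by
  simp [wedge, LinearMap.sum_apply, Finset.sum_apply]

theorem contraction_apply (b : Fin n → A) (v : ExtMod n A) (I : Finset (Fin n)) :
    contraction b v I = ∑ i, b i * del A i v I := by
  simp [contraction, LinearMap.sum_apply, Finset.sum_apply]

theorem IsHomogeneousOfDegree.wedge {d : ℕ} {v : ExtMod n A} (hv : IsHomogeneousOfDegree d v)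
    (c : Fin n → A) : IsHomogeneousOfDegree (d + 1) (wedge c v) := by
  intro I hI
  rw [wedge_apply]
  refine Finset.sum_eq_zero fun i _ => ?_
  rw [theta_apply]
  split_ifs with h
  · rw [hv, mul_zero, mul_zero]
    have := Finset.card_erase_add_one h
    omega
  · rw [mul_zero]

theorem IsHomogeneousOfDegree.contraction {d : ℕ} {v : ExtMod n A}
    (hv : IsHomogeneousOfDegree (d + 1) v) (b : Fin n → A) :
    IsHomogeneousOfDegree d (contraction b v) := by
  intro I hI
  rw [contraction_apply]
  refine Finset.sum_eq_zero fun i _ => ?_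
  rw [del_apply]
  split_ifs with h
  · rw [mul_zero]
  · rw [hv, mul_zero, mul_zero]
    have := Finset.card_insert_of_notMem h
    omega

theorem wedge_mem {Q : Ideal A} {v : ExtMod n A} (hv : ∀ I, v I ∈ Q) (c : Fin n → A)
    (I : Finset (Fin n)) : wedge c v I ∈ Q := by
  rw [wedge_apply]
  refine Q.sum_mem fun i _ => Q.mul_mem_left _ ?_
  rw [theta_apply]
  split_ifs
  · exact Q.mul_mem_left _ (hv _)
  · exact Q.zero_mem

theorem contraction_mem {Q : Ideal A} {v : ExtMod n A} (hv : ∀ I, v I ∈ Q) (b : Fin n → A)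
    (I : Finset (Fin n)) : contraction b v I ∈ Q := by
  rw [contraction_apply]
  refine Q.sum_mem fun i _ => Q.mul_mem_left _ ?_
  rw [del_apply]
  split_ifs
  · exact Q.zero_mem
  · exact Q.mul_mem_left _ (hv _)

/-- Depth sensitivity of the Koszul complex: if the ideal of `b` contains a family `p` that is
regular in every order, then the Koszul complex of `b` modulo a part `(p_t, t ∈ s)` of the family
is exact in the degrees above `n - #(univ \ s)`. -/
theorem exists_contraction_sub_mem {T : Type*} [Fintype T] [DecidableEq T] {b : Fin n → A}
    {p : T → A} (hp : ∀ t, p t ∈ Ideal.span (Set.range b))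
    (hreg : ∀ (s : Finset T) (t : T), t ∉ s → ∀ x, p t * x ∈ Ideal.span (p '' s) →
      x ∈ Ideal.span (p '' s)) (m : ℕ) :
    ∀ (s : Finset T) (d : ℕ) (v : ExtMod n A), sᶜ.card = m → n < d + m →
      IsHomogeneousOfDegree d v → (∀ I, contraction b v I ∈ Ideal.span (p '' s)) →
      ∃ u, IsHomogeneousOfDegree (d + 1) u ∧ ∀ I, (v - contraction b u) I ∈ Ideal.span (p '' s) := by
  induction m with
  | zero =>
    intro s d v _ hd hv _
    -- For `m = 0` the bound reads `n < d`; no `θ_I` has such a degree, so `v = 0`.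
    refine ⟨0, fun _ _ => rfl, fun I => ?_⟩
    have := Finset.card_le_univ I
    rw [Fintype.card_fin] at this
    rw [map_zero, sub_zero, hv I (by omega)]
    exact Ideal.zero_mem _
  | succ m ih =>
    intro s d v hs hd hv hclosed
    obtain ⟨t, ht⟩ : sᶜ.Nonempty := Finset.card_pos.1 (by omega)
    have hts : t ∉ s := Finset.mem_compl.1 ht
    obtain ⟨c, hc⟩ := (Ideal.mem_span_range_iff_exists_fun).1 (hp t)
    have hhom : contraction b (wedge c v) = p t • v - wedge c (contraction b v) := by
      have := LinearMap.congr_fun (contraction_mul_wedge b c) v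
      rw [hc] at this
      exact eq_sub_of_add_eq this
    have hspan : Ideal.span (p '' (insert t s : Finset T))
        = Ideal.span {p t} ⊔ Ideal.span (p '' s) := by
      rw [Finset.coe_insert, Set.image_insert_eq, Ideal.span_insert]
    have hle : Ideal.span (p '' s) ≤ Ideal.span (p '' (insert t s : Finset T)) :=
      hspan ▸ le_sup_right
    -- By the homotopy formula `wedge c v` is a cycle once `p t` is also divided out. The degree
    -- rises as `m` drops, so the bound `n < d + m` is preserved.
    obtain ⟨w, hw, hw'⟩ := ih (insert t s) (d + 1) (wedge c v)
      (by rw [Finset.compl_insert, Finset.card_erase_of_mem ht, hs]; rfl) (by omega)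
      (hv.wedge c) (fun I => by
        rw [hhom]
        refine Ideal.sub_mem _ (Ideal.mul_mem_right _ _ (Ideal.subset_span ⟨t, by simp, rfl⟩)) ?_
        exact hle (wedge_mem hclosed c I))
    have hsplit : ∀ I, ∃ r, (wedge c v - contraction b w) I - p t * r ∈ Ideal.span (p '' s) := by
      intro I
      have := hw' I
      rw [hspan, Ideal.mem_span_singleton_sup] at this
      obtain ⟨r, q, hq, e⟩ := this
      exact ⟨r, by rw [← e]; ring_nf; exact hq⟩
    choose r hr using hsplit
    -- The chosen `r` need not be homogeneous. Truncating it is harmless since `wedge c v -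
    -- contraction b w` lives in degree `d + 1`.
    let u : ExtMod n A := fun I => if I.card = d + 1 then r I else 0
    have hu : IsHomogeneousOfDegree (d + 1) u := fun I hI => if_neg hI
    have hur : ∀ I, (wedge c v - contraction b w - p t • u) I ∈ Ideal.span (p '' s) := by
      intro I
      by_cases hI : I.card = d + 1
      · simpa [u, hI] using hr I
      · have h1 := hv.wedge c I hI
        have h2 := hw.contraction b I hI
        simp [u, hI, h1, h2]
    refine ⟨u, hu, fun I => hreg s t hts _ ?_⟩
    have hBB : contraction b (contraction b w) = 0 :=
      LinearMap.congr_fun (sum_smul_mul_self Finset.univ b (del A) del_mul_self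
        fun i j h => del_anticomm h) w
    -- Contracting `wedge c v ≡ contraction b w + p t • u` shows that `p t` times the desired
    -- difference lies in the ideal of `s`; regularity then cancels `p t`.
    have key : p t • (v - contraction b u)
        = contraction b (wedge c v - contraction b w - p t • u) + wedge c (contraction b v) := by
      rw [map_sub, map_sub, hBB, hhom, map_smul, smul_sub]
      abel
    have := congrFun key I
    rw [Pi.smul_apply, smul_eq_mul] at this
    rw [this]
    exact Ideal.add_mem _ (contraction_mem hur b I) (wedge_mem hclosed c I)

/-- If the contraction is exact in positive degrees, then a cycle of `∑ (a_i θ_i + b_i ∂_i)`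
without constant term is a boundary. -/
theorem exists_koszulD_eq {a b : Fin n → A} (hab : ∑ i, a i * b i = 0)
    (hex : ∀ d, 0 < d → ∀ v, IsHomogeneousOfDegree d v → contraction b v = 0 →
      ∃ u, IsHomogeneousOfDegree (d + 1) u ∧ contraction b u = v)
    {v : ExtMod n A} (hv : koszulD a b v = 0) (h0 : v ∅ = 0) : ∃ u, koszulD a b u = v := by
  have hsq : ∀ u, koszulD a b (koszulD a b u) = 0 := by
    intro u
    have := LinearMap.congr_fun (koszulD_mul_self a b) u
    rwa [hab, zero_smul] at this
  -- Descending induction on the lowest degree `d` that may occur in `v`; beyond `d = n` nothing is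
  -- left.
  have key : ∀ m d : ℕ, d + m = n + 1 → 0 < d → ∀ v : ExtMod n A, koszulD a b v = 0 →
      (∀ I, I.card < d → v I = 0) → ∃ u, koszulD a b u = v := by
    intro m
    induction m with
    | zero =>
      intro d hd _ v _ hlow
      refine ⟨0, ?_⟩
      rw [map_zero]
      funext I
      have := Finset.card_le_univ I
      rw [Fintype.card_fin] at this
      rw [hlow I (by omega), Pi.zero_apply]
    | succ m ih =>
      intro d hd hpos v hv hlow
      let v' : ExtMod n A := fun I => if I.card = d then v I else 0
      have hv' : IsHomogeneousOfDegree d v' := fun I hI => if_neg hI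
      -- The degree `d - 1` part of `koszulD a b v` is `contraction b v'` alone: a wedge
      -- contribution would come from degree `d - 2`, where `v` vanishes.
      have hclosed : contraction b v' = 0 := by
        obtain ⟨d, rfl⟩ := Nat.exists_eq_add_of_lt hpos
        rw [zero_add] at *
        funext I
        by_cases hI : I.card = d
        · have h1 := congrFun hv I
          rw [koszulD_eq_wedge_add_contraction, LinearMap.add_apply, Pi.add_apply, wedge_apply,
            Finset.sum_eq_zero, zero_add] at h1
          · rw [← h1, contraction_apply, contraction_apply]
            refine Finset.sum_congr rfl fun i _ => ?_
            rw [del_apply, del_apply]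
            split_ifs with hi
            · rfl
            · simp [v', Finset.card_insert_of_notMem hi, hI]
          · intro i _
            rw [theta_apply]
            split_ifs with hi
            · rw [hlow, mul_zero, mul_zero]
              have := Finset.card_erase_add_one hi
              omega
            · rw [mul_zero]
        · exact hv'.contraction b I hI
      obtain ⟨u, hu, huv⟩ := hex d hpos v' hv' hclosed
      -- The subtraction removes the degree `d` component; the error `wedge a u` sits in degree `d +
      -- 2`.
      obtain ⟨z, hz⟩ := ih (d + 1) (by omega) (by omega) (v - koszulD a b u)
        (by rw [map_sub, hv, hsq, sub_zero]) (fun I hI => by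
          rw [koszulD_eq_wedge_add_contraction, LinearMap.add_apply, huv, Pi.sub_apply,
            Pi.add_apply, hu.wedge a I (by omega), zero_add]
          by_cases hI' : I.card = d
          · simp [v', hI']
          · rw [hlow I (by omega), hv' I hI', sub_zero])
      exact ⟨z + u, by rw [map_add, hz, sub_add_cancel]⟩
  exact key n 1 (by omega) one_pos v hv fun I hI => by
    rw [Finset.card_eq_zero.1 (Nat.lt_one_iff.1 hI), h0]

end KoszulExact

/-! ### Modules with canonical anticommutation relations -/

section Transport

variable {n : ℕ} {A : Type u} [CommRing A] {C : Type u} [AddCommGroup C] [Module A C]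

/-- The operator `ι_{i_r} ⋯ ι_{i_1}` for `I = {i_1 < ⋯ < i_r}`. -/
noncomputable def annihilators (ι : Fin n → Module.End A C) (I : Finset (Fin n)) :
    Module.End A C :=
  ((I.sort (· ≤ ·)).map ι).reverse.prod

variable {ι E : Fin n → Module.End A C} {l : C →ₗ[A] A}

theorem annihilators_empty : annihilators ι ∅ = 1 := by simp [annihilators]

/-- The list is reversed, so the smallest index acts first; inductions can then split off the
minimum. -/
theorem annihilators_insert_of_lt {a : Fin n} {I : Finset (Fin n)} (h : ∀ x ∈ I, a < x) :
    annihilators ι (insert a I) = annihilators ι I * ι a := by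
  have ha : a ∉ I := fun h' => lt_irrefl _ (h a h')
  rw [annihilators, Finset.sort_insert (· ≤ ·) (fun x hx => (h x hx).le) ha]
  simp [annihilators]

theorem kSign_eq_one {a : Fin n} {I : Finset (Fin n)} (h : ∀ x ∈ I, a ≤ x) : kSign A a I = 1 := by
  rw [kSign, Finset.filter_eq_empty_iff.2 fun x hx => not_lt.2 (h x hx), Finset.card_empty,
    pow_zero]

/-- To reach its sorted place, `ι t` moves left past exactly the factors with index below `t`, each
costing a sign. -/
theorem annihilators_mul_of_notMem (hι : ∀ i j, ι i * ι j + ι j * ι i = 0) {t : Fin n}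
    (I : Finset (Fin n)) (ht : t ∉ I) :
    annihilators ι I * ι t = kSign A t I • annihilators ι (insert t I) := by
  induction I using Finset.induction_on_min with
  | empty =>
    rw [kSign_eq_one (by simp), one_smul, annihilators_insert_of_lt (by simp)]
  | insert a s ha ih =>
    rw [Finset.mem_insert, not_or] at ht
    rcases lt_or_gt_of_ne ht.1 with h | h
    · have h' : ∀ x ∈ insert a s, t < x := by
        intro x hx
        rcases Finset.mem_insert.1 hx with rfl | hx
        · exact h
        · exact h.trans (ha x hx)
      rw [kSign_eq_one (fun x hx => (h' x hx).le), one_smul, ← annihilators_insert_of_lt h']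
    · have h' : ∀ x ∈ insert t s, a < x := by
        intro x hx
        rcases Finset.mem_insert.1 hx with rfl | hx
        · exact h
        · exact ha x hx
      rw [annihilators_insert_of_lt ha, mul_assoc, eq_neg_of_add_eq_zero_left (hι a t), mul_neg,
        ← mul_assoc, ih ht.2, smul_mul_assoc, ← annihilators_insert_of_lt h', Finset.insert_comm,
        kSign_insert_of_lt h (fun h => lt_irrefl _ (ha a h)), neg_smul]

/-- Up to sign the factor `ι t` can be put last, where it meets a second `ι t`. The squares are a
separate hypothesis because anticommutation only gives `2 ι² = 0`. -/
theorem annihilators_mul_of_mem (hι : ∀ i j, ι i * ι j + ι j * ι i = 0)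
    (hι2 : ∀ i, ι i * ι i = 0) {t : Fin n} {I : Finset (Fin n)} (ht : t ∈ I) :
    annihilators ι I * ι t = 0 := by
  have h := annihilators_mul_of_notMem hι (I.erase t) (Finset.notMem_erase t I)
  rw [Finset.insert_erase ht] at h
  have h2 := congrArg (fun z => kSign A t (I.erase t) • (z * ι t)) h
  simp only [mul_assoc, hι2, mul_zero, smul_zero, smul_mul_assoc, smul_smul, kSign_mul_self,
    one_smul] at h2
  exact h2.symm

/-- `E t` passes every `ι i` with `i ≠ t` up to sign and ends up outermost, where `l` kills it. -/
theorem apply_annihilators_of_notMem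
    (hE : ∀ i j, ι i * E j + E j * ι i = if i = j then 1 else 0) (hl : ∀ i x, l (E i x) = 0)
    {t : Fin n} (I : Finset (Fin n)) (ht : t ∉ I) (x : C) : l (annihilators ι I (E t x)) = 0 := by
  induction I using Finset.induction_on_min generalizing x with
  | empty => rw [annihilators_empty, Module.End.one_apply, hl]
  | insert a s ha ih =>
    rw [Finset.mem_insert, not_or] at ht
    have h := LinearMap.congr_fun (hE a t) x
    rw [if_neg (Ne.symm ht.1)] at h
    rw [annihilators_insert_of_lt ha, Module.End.mul_apply,
      show ι a (E t x) = -E t (ι a x) from eq_neg_of_add_eq_zero_left h, map_neg, map_neg,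
      ih ht.2, neg_zero]

/-- Only the exchange of `E t` with `ι t` leaves a remainder, namely the identity; the exchanged
term dies as in `apply_annihilators_of_notMem`. -/
theorem apply_annihilators_of_mem (hι : ∀ i j, ι i * ι j + ι j * ι i = 0)
    (hE : ∀ i j, ι i * E j + E j * ι i = if i = j then 1 else 0) (hl : ∀ i x, l (E i x) = 0)
    {t : Fin n} {I : Finset (Fin n)} (ht : t ∈ I) (x : C) :
    l (annihilators ι I (E t x)) = kSign A t I • l (annihilators ι (I.erase t) x) := by
  have h := annihilators_mul_of_notMem hι (I.erase t) (Finset.notMem_erase t I)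
  rw [Finset.insert_erase ht] at h
  have h1 : annihilators ι I = kSign A t (I.erase t) • (annihilators ι (I.erase t) * ι t) := by
    rw [h, smul_smul, kSign_mul_self, one_smul]
  have h2 := LinearMap.congr_fun (hE t t) x
  rw [if_pos rfl] at h2
  rw [h1, LinearMap.smul_apply, Module.End.mul_apply,
    show ι t (E t x) = x - E t (ι t x) from eq_sub_of_add_eq h2, map_smul, map_sub, map_sub,
    apply_annihilators_of_notMem hE hl _ (Finset.notMem_erase t I), sub_zero,
    kSign_erase_of_le le_rfl]

/-- The coordinates `l(ι_{i_r} ⋯ ι_{i_1} x)` of `x` with respect to the operators `ι`. -/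
noncomputable def coordinates (ι : Fin n → Module.End A C) (l : C →ₗ[A] A) :
    C →ₗ[A] ExtMod n A :=
  LinearMap.pi fun I => l ∘ₗ annihilators ι I

theorem coordinates_apply (x : C) (I : Finset (Fin n)) :
    coordinates ι l x I = l (annihilators ι I x) := rfl

theorem coordinates_creation (hι : ∀ i j, ι i * ι j + ι j * ι i = 0)
    (hE : ∀ i j, ι i * E j + E j * ι i = if i = j then 1 else 0) (hl : ∀ i x, l (E i x) = 0)
    (t : Fin n) (x : C) : coordinates ι l (E t x) = theta A t (coordinates ι l x) := by
  funext I
  rw [coordinates_apply, theta_apply]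
  split_ifs with ht
  · rw [apply_annihilators_of_mem hι hE hl ht, smul_eq_mul, coordinates_apply]
  · exact apply_annihilators_of_notMem hE hl I ht x

theorem coordinates_annihilation (hι : ∀ i j, ι i * ι j + ι j * ι i = 0)
    (hι2 : ∀ i, ι i * ι i = 0) (t : Fin n) (x : C) :
    coordinates ι l (ι t x) = del A t (coordinates ι l x) := by
  funext I
  rw [coordinates_apply, del_apply, ← Module.End.mul_apply]
  split_ifs with ht
  · rw [annihilators_mul_of_mem hι hι2 ht, LinearMap.zero_apply, map_zero]
  · rw [annihilators_mul_of_notMem hι I ht, LinearMap.smul_apply, map_smul, smul_eq_mul,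
      coordinates_apply]

/-- The vacuum `x₀` has coordinates `θ_∅`, and creation operators applied with the smallest index
last produce every `θ_I` without signs. -/
theorem coordinates_surjective (hι : ∀ i j, ι i * ι j + ι j * ι i = 0)
    (hE : ∀ i j, ι i * E j + E j * ι i = if i = j then 1 else 0) (hl : ∀ i x, l (E i x) = 0)
    {x₀ : C} (hx₀ : ∀ i, ι i x₀ = 0) (hlx₀ : l x₀ = 1) :
    Function.Surjective (coordinates ι l) := by
  have hbasis : ∀ I, ∃ x, coordinates ι l x = thetaBasis A I := by
    intro I
    induction I using Finset.induction_on_min with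
    | empty =>
      refine ⟨x₀, funext fun I => ?_⟩
      rw [thetaBasis_apply, coordinates_apply]
      split_ifs with hI
      · rw [hI, annihilators_empty, Module.End.one_apply, hlx₀]
      · obtain ⟨t, ht, hmin⟩ := Finset.exists_minimal (Finset.nonempty_iff_ne_empty.2 hI)
        have hlt : ∀ x ∈ I.erase t, t < x := fun x hx =>
          lt_of_le_of_ne (not_lt.1 fun h => lt_irrefl _
            (h.trans_le (hmin (Finset.mem_of_mem_erase hx) h.le)))
            (Finset.ne_of_mem_erase hx).symm
        rw [← Finset.insert_erase ht, annihilators_insert_of_lt hlt, Module.End.mul_apply, hx₀,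
          map_zero, map_zero]
    | insert a s ha ih =>
      obtain ⟨x, hx⟩ := ih
      refine ⟨E a x, ?_⟩
      rw [coordinates_creation hι hE hl, hx, theta_thetaBasis fun h => lt_irrefl _ (ha a h),
        kSign_eq_one fun x hx => (ha x hx).le, one_smul]
  choose x hx using hbasis
  intro v
  refine ⟨∑ I, v I • x I, ?_⟩
  rw [map_sum]
  conv_rhs => rw [← sum_smul_thetaBasis v]
  exact Finset.sum_congr rfl fun I _ => by rw [map_smul, hx]

/-- In a free module of rank `2ⁿ` with canonical anticommutation relations, a cycle of
`∑ (a_i E_i + b_i ι_i)` with vanishing vacuum coefficient is a boundary provided that the Koszul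
complex of `b` is exact in positive degrees. -/
theorem exists_sum_apply_eq (e : C ≃ₗ[A] ExtMod n A) (hι : ∀ i j, ι i * ι j + ι j * ι i = 0)
    (hι2 : ∀ i, ι i * ι i = 0)
    (hE : ∀ i j, ι i * E j + E j * ι i = if i = j then 1 else 0) (hl : ∀ i x, l (E i x) = 0)
    {x₀ : C} (hx₀ : ∀ i, ι i x₀ = 0) (hlx₀ : l x₀ = 1)
    {a b : Fin n → A} (hab : ∑ i, a i * b i = 0)
    (hex : ∀ d, 0 < d → ∀ v, IsHomogeneousOfDegree d v → contraction b v = 0 →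
      ∃ u, IsHomogeneousOfDegree (d + 1) u ∧ contraction b u = v)
    {x : C} (hx : (∑ i, (a i • E i + b i • ι i)) x = 0) (h0 : l x = 0) :
    ∃ s, (∑ i, (a i • E i + b i • ι i)) s = x := by
  have hsurj := coordinates_surjective hι hE hl hx₀ hlx₀
  -- Source and target are free of the same finite rank, so surjectivity forces injectivity.
  have hinj : Function.Injective (coordinates ι l) := by
    have : Module.Finite A C := Module.Finite.equiv e.symm
    have h := OrzechProperty.injective_of_surjective_endomorphism
      (e.symm.toLinearMap ∘ₗ coordinates ι l)
      (by rw [LinearMap.coe_comp]; exact e.symm.surjective.comp hsurj)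
    rw [LinearMap.coe_comp] at h
    exact h.of_comp
  have hD : ∀ x, coordinates ι l ((∑ i, (a i • E i + b i • ι i)) x)
      = koszulD a b (coordinates ι l x) := by
    intro x
    simp only [koszulD, LinearMap.sum_apply, map_sum, LinearMap.add_apply, LinearMap.smul_apply,
      map_add, map_smul, coordinates_creation hι hE hl, coordinates_annihilation hι hι2]
  obtain ⟨u, hu⟩ := exists_koszulD_eq hab hex (v := coordinates ι l x)
    (by rw [← hD, hx, map_zero])
    (by rw [coordinates_apply, annihilators_empty, Module.End.one_apply, h0])
  obtain ⟨s, rfl⟩ := hsurj u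
  exact ⟨s, hinj (by rw [hD, hu])⟩

end Transport

/-! ### Regular families and the fixed locus -/

section Regular

variable {k : Type u} [Field k]

/-- Monic polynomials in pairwise different variables form a regular family. -/
theorem mem_span_of_monic_mul_mem {σ : Type*} [DecidableEq σ] {p : σ → Polynomial k}
    (hp : ∀ i, (p i).Monic) {s : Set σ} {i : σ} (hi : i ∉ s) {x : MvPolynomial σ k}
    (hx : Polynomial.aeval (X i) (p i) * x
      ∈ Ideal.span ((fun j => Polynomial.aeval (X j : MvPolynomial σ k) (p j)) '' s)) :
    x ∈ Ideal.span ((fun j => Polynomial.aeval (X j : MvPolynomial σ k) (p j)) '' s) := by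
  -- Singles out `X i` as a polynomial variable. Since `i ∉ s`, the generators indexed by `s` become
  -- constants.
  let e : MvPolynomial σ k ≃ₐ[k] Polynomial (MvPolynomial {j // j ≠ i} k) :=
    (renameEquiv k (Equiv.optionSubtypeNe i).symm).trans (optionEquivLeft k _)
  let Q : Ideal (MvPolynomial {j // j ≠ i} k) :=
    Ideal.span ((fun j => Polynomial.aeval (X j) (p j)) '' (Subtype.val ⁻¹' s))
  have ei : e (X i) = Polynomial.X := by simp [e]
  have ej : ∀ j : {j // j ≠ i}, e (X j) = Polynomial.C (X j) := by
    intro j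
    simp [e, Equiv.optionSubtypeNe_symm_of_ne j.2]
  have hQ : Ideal.map e (Ideal.span
      ((fun j => Polynomial.aeval (X j : MvPolynomial σ k) (p j)) '' s))
      = Ideal.map Polynomial.C Q := by
    rw [Ideal.map_span, Ideal.map_span, ← Set.image_comp, ← Set.image_comp]
    congr 1
    have key : ∀ j : {j // j ≠ i}, e (Polynomial.aeval (X (j : σ)) (p j))
        = Polynomial.C (Polynomial.aeval (X j) (p j)) := by
      intro j
      have h1 := Polynomial.aeval_algHom_apply e.toAlgHom (X (j : σ)) (p j)
      have h2 := Polynomial.aeval_algHom_apply (Polynomial.CAlgHom (R := k)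
        (A := MvPolynomial {j // j ≠ i} k)) (X j) (p j)
      rw [show e.toAlgHom (X (j : σ)) = Polynomial.C (X j) from ej j] at h1
      exact h1.symm.trans h2
    ext z
    constructor
    · rintro ⟨j, hj, rfl⟩
      have : j ≠ i := fun h => hi (h ▸ hj)
      exact ⟨⟨j, this⟩, hj, (key ⟨j, this⟩).symm⟩
    · rintro ⟨j, hj, rfl⟩
      exact ⟨j, hj, key j⟩
  -- The ideal is extended from the coefficients, so membership means vanishing after reducing
  -- coefficients modulo `Q`.
  have hmem : ∀ z, z ∈ Ideal.span ((fun j => Polynomial.aeval (X j : MvPolynomial σ k) (p j)) '' s)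
      ↔ (e z).map (Ideal.Quotient.mk Q) = 0 := by
    intro z
    rw [← Polynomial.coe_mapRingHom, ← RingHom.mem_ker, Polynomial.ker_mapRingHom,
      Ideal.mk_ker, ← hQ]
    constructor
    · exact Ideal.mem_map_of_mem e
    · intro h
      rwa [← Ideal.mem_comap, Ideal.comap_map_of_bijective e e.bijective] at h
  rw [hmem] at hx ⊢
  have hpi : e (Polynomial.aeval (X i) (p i)) = (p i).map C := by
    have h1 := Polynomial.aeval_algHom_apply e.toAlgHom (X i) (p i)
    rw [show e.toAlgHom (X i) = Polynomial.X from ei] at h1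
    exact h1.symm
  rw [map_mul, Polynomial.map_mul, hpi] at hx
  -- A monic polynomial is a nonzerodivisor over any commutative ring, so `Q` need not be prime.
  exact (((hp i).map C).map _).mul_right_eq_zero_iff.1 hx

/-- An ideal of finite codimension contains a monic polynomial in each variable. -/
theorem exists_monic_aeval_mem {σ : Type*} (J : Ideal (MvPolynomial σ k))
    [Module.Finite k (MvPolynomial σ k ⧸ J)] (i : σ) :
    ∃ p : Polynomial k, p.Monic ∧ Polynomial.aeval (X i) p ∈ J := by
  obtain ⟨p, hp, h⟩ := IsIntegral.of_finite k (Ideal.Quotient.mkₐ k J (X i))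
  refine ⟨p, hp, Ideal.Quotient.eq_zero_iff_mem.1 ?_⟩
  rw [← Polynomial.aeval_def, Polynomial.aeval_algHom_apply] at h
  exact h

/-- Elements of a polynomial ring as many as the variables that generate an ideal of finite
codimension have a Koszul complex that is exact in positive degrees. -/
theorem exists_contraction_eq {σ : Type} [Fintype σ] {N : ℕ} (hN : Fintype.card σ = N)
    (b : Fin N → MvPolynomial σ k)
    [Module.Finite k (MvPolynomial σ k ⧸ Ideal.span (Set.range b))] (d : ℕ) (hd : 0 < d)
    (v : ExtMod N (MvPolynomial σ k)) (hv : IsHomogeneousOfDegree d v)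
    (h : contraction b v = 0) :
    ∃ u, IsHomogeneousOfDegree (d + 1) u ∧ contraction b u = v := by
  classical
  choose p hp hmem using exists_monic_aeval_mem (Ideal.span (Set.range b))
  -- With `s = ∅` the ideal is zero and `m = N`, so the degree bound becomes `0 < d`.
  obtain ⟨u, hu, huv⟩ := exists_contraction_sub_mem hmem
    (fun s t ht x hx => mem_span_of_monic_mul_mem hp (by simpa using ht) hx) N ∅ d v
    (by simp [hN]) (by omega) hv (fun I => by rw [h]; exact Ideal.zero_mem _)
  refine ⟨u, hu, funext fun I => ?_⟩
  have := huv I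
  simp only [Finset.coe_empty, Set.image_empty, Ideal.span_empty, Ideal.mem_bot] at this
  exact (sub_eq_zero.1 this).symm

end Regular

/-! ### Difference quotients on the diagonal and finiteness over the fixed locus -/

section FixedLocus

variable {k : Type u} [Field k] {n : ℕ}

/-- The restriction of `r(x, y)` to the diagonal `y = x`. -/
noncomputable def diag (k : Type u) [Field k] (n : ℕ) :
    DoubleRing k n →ₐ[k] MvPolynomial (Fin n) k :=
  aeval (Sum.elim X X)

theorem diag_mixed (W : MvPolynomial (Fin n) k) (m : ℕ) : diag k n (mixed W m) = W := by
  conv_rhs => rw [← aeval_X_left_apply W]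
  rw [mixed, ← AlgHom.comp_apply]
  congr 1
  ext i : 1
  simp only [AlgHom.comp_apply, aeval_X]
  split_ifs <;> simp [diag, xv, yv]

/-- The variable `y_i` has replaced `x_i` in `mixed W m` exactly when `i < m` (indices from `0`);
otherwise `y_i` does not occur. -/
theorem diag_pderiv_mixed (W : MvPolynomial (Fin n) k) (i : Fin n) (m : ℕ) :
    diag k n (pderiv (Sum.inr i) (mixed W m)) = if (i : ℕ) < m then pderiv i W else 0 := by
  induction W using MvPolynomial.induction_on with
  | C c => simp [mixed]
  | add p q hp hq =>
    rw [show mixed (p + q) m = mixed p m + mixed q m from map_add _ _ _, map_add, map_add, hp, hq,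
      map_add]
    split_ifs <;> simp
  | mul_X p j hp =>
    have hX : diag k n (pderiv (Sum.inr i) (mixed (X j) m))
        = if (i : ℕ) < m then pderiv i (X j) else 0 := by
      rw [mixed, aeval_X]
      by_cases hj : j = i
      · subst hj
        split_ifs <;> simp [xv, yv, pderiv_X]
      · split_ifs <;> simp [xv, yv, pderiv_X, hj]
    rw [show mixed (p * X j) m = mixed p m * mixed (X j) m from map_mul _ _ _, pderiv_mul,
      map_add, map_mul, map_mul, hp, hX, diag_mixed, diag_mixed, pderiv_mul]
    split_ifs <;> simp

/-- The difference quotient restricts to the partial derivative on the diagonal. -/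
theorem diag_nabla (W : MvPolynomial (Fin n) k) (i : Fin n) :
    diag k n (nabla W i) = pderiv i W := by
  -- Differentiating the defining equation in `y_i` avoids division: on the diagonal the term still
  -- carrying `y_i - x_i` disappears.
  have h := congrArg (fun z => diag k n (pderiv (Sum.inr i) z)) (sub_mul_nabla W i)
  simp only [map_sub, pderiv_mul, map_add, map_mul, diag_pderiv_mixed] at h
  simpa [diag, xv, yv, pderiv_X] using h

/-- Chain rule applied to `W(ax) = W(x)`. On the fixed locus it forces `∂_i W = 0` whenever `a i ≠
1`. -/
theorem pderiv_of_isInvariant {W : MvPolynomial (Fin n) k} {a : Fin n → kˣ}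
    (h : IsInvariant W a) (i : Fin n) :
    C (a i : k) * aeval (fun j => C (a j : k) * X j) (pderiv i W) = pderiv i W := by
  have key : ∀ V : MvPolynomial (Fin n) k, pderiv i (aeval (fun j => C (a j : k) * X j) V)
      = C (a i : k) * aeval (fun j => C (a j : k) * X j) (pderiv i V) := by
    intro V
    induction V using MvPolynomial.induction_on with
    | C c => simp
    | add p q hp hq => simp only [map_add, hp, hq, mul_add]
    | mul_X p j hp =>
      simp only [map_mul, map_add, pderiv_mul, hp, aeval_X, pderiv_C, pderiv_X]
      by_cases hj : j = i
      · subst hj; simp; ring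
      · simp [hj]; ring
  rw [← key, h]

/-- An ideal that contains the equations of the diagonal, of the fixed locus of `a`, and of the
critical locus of `W` in the fixed directions has finite codimension if `W` has an isolated
singularity. -/
theorem finite_quotient_of_finite_jac {W : MvPolynomial (Fin n) k} {a : Fin n → kˣ}
    (h : IsInvariant W a) (hiso : Module.Finite k (Jac W)) {J : Ideal (DoubleRing k n)}
    (hJ₁ : ∀ i, twX 1 i ∈ J) (hJ₂ : ∀ i, a i ≠ 1 → twX a i - twX 1 i ∈ J)
    (hJ₃ : ∀ i, a i = 1 → twNabla W a i ∈ J) : Module.Finite k (DoubleRing k n ⧸ J) := by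
  let q := Ideal.Quotient.mkₐ k J
  have hq : ∀ {z}, z ∈ J → q z = 0 := fun hz => Ideal.Quotient.eq_zero_iff_mem.2 hz
  let f : MvPolynomial (Fin n) k →ₐ[k] DoubleRing k n ⧸ J := aeval fun i => q (xv k i)
  have hy : ∀ i, q (yv k i) = q (xv k i) := by
    intro i
    have := hq (hJ₁ i)
    rw [twX, map_sub, sub_eq_zero] at this
    simpa using this
  -- For a moved index, the generator `twX a i - twX 1 i` equals `(1 - a_i) x_i`.
  have hx : ∀ i, q (C (a i : k) * xv k i) = q (xv k i) := by
    intro i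
    by_cases hi : a i = 1
    · simp [hi]
    · have := hq (hJ₂ i hi)
      rw [twX, twX, map_sub, map_sub, map_sub] at this
      simp only [Pi.one_apply, Units.val_one, C_1, one_mul] at this
      rw [sub_sub_sub_cancel_left, sub_eq_zero] at this
      exact this.symm
  -- Modulo `J` one has `ax = x = y`, so the twisted substitution is restriction to the diagonal.
  have hdiag : ∀ z, q (scale a 1 z) = f (diag k n z) := by
    intro z
    rw [← AlgHom.comp_apply, ← AlgHom.comp_apply]
    congr 1
    ext i : 1
    rcases i with i | i
    · change q (scale a 1 (xv k i)) = f (diag k n (xv k i))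
      rw [scale_xv, hx]
      simp [diag, xv, f]
    · change q (scale a 1 (yv k i)) = f (diag k n (yv k i))
      rw [scale_yv]
      simp [diag, yv, f, ← hy]
  have hf : ∀ z, f (aeval (fun j => C (a j : k) * X j) z) = f z := by
    intro z
    rw [← AlgHom.comp_apply]
    congr 1
    ext i : 1
    have := hx i
    rw [map_mul] at this
    simpa [f, ← algebraMap_eq] using this
  have hW : ∀ i, f (pderiv i W) = 0 := by
    intro i
    by_cases hi : a i = 1
    · have := hq (hJ₃ i hi)
      rwa [twNabla, hdiag, diag_nabla] at this
    -- No generator of `J` provides this derivative; invariance gives `(a_i - 1) ∂_i W = 0` in the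
    -- quotient, with `a_i - 1` invertible.
    · have h1 := congrArg f (pderiv_of_isInvariant h i)
      rw [map_mul, hf] at h1
      have h2 : ((a i : k) - 1) • f (pderiv i W) = 0 := by
        rw [sub_smul, one_smul, sub_eq_zero, ← map_smul, smul_eq_C_mul, map_mul]
        exact h1
      exact (smul_eq_zero.1 h2).resolve_left (sub_ne_zero.2 fun e => hi (Units.ext e))
  let g : Jac W →ₐ[k] DoubleRing k n ⧸ J := Ideal.Quotient.liftₐ _ f fun z hz => by
    have : Ideal.span (Set.range fun i => pderiv i W) ≤ RingHom.ker f :=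
      Ideal.span_le.2 (by rintro _ ⟨i, rfl⟩; exact hW i)
    exact this hz
  refine Module.Finite.of_surjective g.toLinearMap ?_
  intro z
  obtain ⟨z, rfl⟩ := Ideal.Quotient.mk_surjective z
  refine ⟨Ideal.Quotient.mk _ (aeval (Sum.elim X X) z), ?_⟩
  have : f.comp (diag k n) = q := by
    ext i : 1
    rcases i with i | i
    · simp [f, diag]; rfl
    · have := hy i
      simp only [AlgHom.comp_apply, diag, aeval_X, Sum.elim_inr, f]
      exact this.symm
  exact DFunLike.congr_fun this z

end FixedLocus

/-! ### The morphism complex of two Koszul matrix factorizations -/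

section Operators

variable {n : ℕ} {A : Type u} [CommRing A]

/-- The grading involution of `A[θ₁, …, θₙ]`. -/
noncomputable def parity (n : ℕ) (A : Type u) [CommRing A] : Module.End A (ExtMod n A) :=
  LinearMap.pi fun I => ((-1 : A) ^ I.card) • LinearMap.proj I

theorem parity_apply (v : ExtMod n A) (I : Finset (Fin n)) :
    parity n A v I = (-1) ^ I.card * v I := rfl

theorem parity_mul_self : parity n A * parity n A = 1 := by
  refine LinearMap.ext fun v => funext fun I => ?_
  rw [Module.End.mul_apply, parity_apply, parity_apply, ← mul_assoc, ← mul_pow]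
  simp

theorem parity_of_mem {j : ZMod 2} {v : ExtMod n A} (hv : v ∈ extPart n A j) :
    parity n A v = (-1 : A) ^ j.val • v := by
  funext I
  rw [parity_apply, Pi.smul_apply, smul_eq_mul]
  by_cases hI : (I.card : ZMod 2) = j
  · rw [← hI, ZMod.val_natCast, ← neg_one_pow_eq_pow_mod_two]
  · rw [hv I hI, mul_zero, mul_zero]

theorem sgn_koszul_apply (w : A) (a b : Fin n → A) (hw : ∑ i, a i * b i = w) (v : ExtMod n A) :
    (koszul w a b hw).sgn v = parity n A v := by
  have h : (koszul w a b hw).sgn = parity n A := by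
    refine MatrixFactorization.ext_part (fun p hp => ?_) (fun p hp => ?_)
    · refine ((koszul w a b hw).sgn_of_mem_zero hp).trans ((parity_of_mem hp).trans ?_).symm
      rw [ZMod.val_zero, pow_zero]
      exact one_smul A _
    · refine ((koszul w a b hw).sgn_of_mem_one hp).trans ((parity_of_mem hp).trans ?_).symm
      rw [ZMod.val_one, pow_one]
      exact neg_one_smul A _
  exact LinearMap.congr_fun h v

variable {C : Type u} [AddCommGroup C] [Module A C]

/-- The anticommutator. -/
def anticommutator (x y : Module.End A C) : Module.End A C := x * y + y * x

theorem anticommutator_sub_left (x y z : Module.End A C) :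
    anticommutator (x - y) z = anticommutator x z - anticommutator y z := by
  refine LinearMap.ext fun v => ?_
  simp only [anticommutator, LinearMap.add_apply, LinearMap.sub_apply, Module.End.mul_apply,
    map_sub]
  abel

theorem anticommutator_comm (x y : Module.End A C) :
    anticommutator x y = anticommutator y x := add_comm _ _

theorem anticommutator_sub_right (x y z : Module.End A C) :
    anticommutator x (y - z) = anticommutator x y - anticommutator x z := by
  rw [anticommutator_comm, anticommutator_sub_left, anticommutator_comm y, anticommutator_comm z]

theorem sub_mul_sub_self (x y : Module.End A C) :
    (x - y) * (x - y) = x * x - anticommutator x y + y * y := by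
  refine LinearMap.ext fun v => ?_
  simp only [anticommutator, LinearMap.add_apply, LinearMap.sub_apply, Module.End.mul_apply,
    map_sub]
  abel

theorem end_neg_zero : -(0 : Module.End A C) = 0 := neg_zero

theorem end_zero_sub_zero_add_zero : (0 : Module.End A C) - 0 + 0 = 0 := by
  rw [add_zero]
  exact sub_self 0

theorem mul_eq_neg_of_anticommutator {x y : Module.End A C} (h : anticommutator x y = 0) (v : C) :
    x (y v) = -y (x v) :=
  eq_neg_of_add_eq_zero_left (LinearMap.congr_fun h v)

/-- Left multiplication by an endomorphism. -/
noncomputable def leftOp (x : Module.End A (ExtMod n A)) :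
    Module.End A (Module.End A (ExtMod n A)) := LinearMap.mulLeft A x

theorem leftOp_apply (x φ : Module.End A (ExtMod n A)) : leftOp x φ = x * φ := rfl

/-- The operator `φ ↦ (-1)^{|φ|} φ x`. -/
noncomputable def rightOp (x : Module.End A (ExtMod n A)) :
    Module.End A (Module.End A (ExtMod n A)) :=
  LinearMap.mulLeft A (parity n A) * LinearMap.mulRight A (parity n A * x)

theorem rightOp_apply (x φ : Module.End A (ExtMod n A)) :
    rightOp x φ = parity n A * φ * parity n A * x := by
  simp [rightOp, Module.End.mul_apply, mul_assoc]

theorem leftOp_mul_leftOp (x y : Module.End A (ExtMod n A)) :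
    leftOp x * leftOp y = leftOp (x * y) :=
  LinearMap.ext fun φ => (mul_assoc x y φ).symm

theorem anticommutator_leftOp_leftOp (x y : Module.End A (ExtMod n A)) :
    anticommutator (leftOp x) (leftOp y) = leftOp (anticommutator x y) :=
  LinearMap.ext fun _ => LinearMap.ext fun _ => rfl

theorem leftOp_one : leftOp (1 : Module.End A (ExtMod n A)) = 1 := LinearMap.ext fun φ => one_mul φ

theorem leftOp_zero : leftOp (0 : Module.End A (ExtMod n A)) = 0 :=
  LinearMap.ext fun φ => zero_mul φ

theorem anticommutator_parity_theta (i : Fin n) :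
    anticommutator (parity n A) (theta A i) = 0 := by
  refine LinearMap.ext fun v => funext fun I => ?_
  simp only [anticommutator, Module.End.mul_apply, LinearMap.add_apply, Pi.add_apply,
    LinearMap.zero_apply, Pi.zero_apply, parity_apply, theta_apply]
  split_ifs with h
  · rw [← Finset.card_erase_add_one h, pow_succ]
    ring
  · simp

theorem anticommutator_parity_del (i : Fin n) :
    anticommutator (parity n A) (del A i) = 0 := by
  refine LinearMap.ext fun v => funext fun I => ?_
  simp only [anticommutator, Module.End.mul_apply, LinearMap.add_apply, Pi.add_apply,
    LinearMap.zero_apply, Pi.zero_apply, parity_apply, del_apply]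
  split_ifs with h
  · simp
  · rw [Finset.card_insert_of_notMem h, pow_succ]
    ring

theorem parity_parity (v : ExtMod n A) : parity n A (parity n A v) = v :=
  LinearMap.congr_fun parity_mul_self v

/-- Left and right multiplications commute; the conjugation by `parity` inside `rightOp` contributes
the sign because `x` is odd. -/
theorem anticommutator_leftOp_rightOp {x : Module.End A (ExtMod n A)}
    (hx : anticommutator (parity n A) x = 0) (y : Module.End A (ExtMod n A)) :
    anticommutator (leftOp x) (rightOp y) = 0 := by
  refine LinearMap.ext fun φ => LinearMap.ext fun v => ?_
  simp only [anticommutator, LinearMap.add_apply, Module.End.mul_apply, rightOp_apply,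
    leftOp_apply, LinearMap.zero_apply]
  rw [mul_eq_neg_of_anticommutator hx, add_neg_cancel]

/-- The outer parities cancel and the inner ones conjugate the odd `y` to `-y`. Hence the right
operators satisfy the Clifford relations with the opposite sign. -/
theorem rightOp_mul_rightOp (x : Module.End A (ExtMod n A)) {y : Module.End A (ExtMod n A)}
    (hy : anticommutator (parity n A) y = 0) :
    rightOp x * rightOp y = -LinearMap.mulRight A (y * x) := by
  refine LinearMap.ext fun φ => LinearMap.ext fun v => ?_
  simp only [Module.End.mul_apply, rightOp_apply, LinearMap.neg_apply, LinearMap.mulRight_apply]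
  rw [parity_parity, mul_eq_neg_of_anticommutator hy, parity_parity, map_neg]

theorem anticommutator_rightOp_rightOp {x y : Module.End A (ExtMod n A)}
    (hx : anticommutator (parity n A) x = 0) (hy : anticommutator (parity n A) y = 0) :
    anticommutator (rightOp x) (rightOp y) = -LinearMap.mulRight A (anticommutator x y) := by
  rw [anticommutator, rightOp_mul_rightOp x hy, rightOp_mul_rightOp y hx, anticommutator]
  refine LinearMap.ext fun φ => ?_
  simp only [LinearMap.add_apply, LinearMap.neg_apply, LinearMap.mulRight_apply, mul_add]
  abel

theorem anticommutator_theta_theta (i j : Fin n) :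
    anticommutator (theta A i) (theta A j) = 0 := by
  rcases eq_or_ne i j with rfl | h
  · rw [anticommutator, theta_mul_self, add_zero]
  · rw [anticommutator, theta_anticomm h, neg_add_cancel]

theorem anticommutator_del_del (i j : Fin n) : anticommutator (del A i) (del A j) = 0 := by
  rcases eq_or_ne i j with rfl | h
  · rw [anticommutator, del_mul_self, add_zero]
  · rw [anticommutator, del_anticomm h, neg_add_cancel]

theorem anticommutator_del_theta (i j : Fin n) :
    anticommutator (del A i) (theta A j) = if i = j then 1 else 0 := by
  rw [anticommutator, del_mul_theta]
  abel

theorem anticommutator_theta_del (i j : Fin n) :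
    anticommutator (theta A i) (del A j) = if i = j then 1 else 0 := by
  rw [anticommutator_comm, anticommutator_del_theta]
  simp only [eq_comm]

/-- The annihilation operators of the morphism complex. -/
noncomputable def homAnnihilation (H : Finset (Fin n)) :
    Fin n ⊕ Fin n → Module.End A (Module.End A (ExtMod n A)) :=
  Sum.elim (fun i => leftOp (theta A i) - rightOp (theta A i))
    fun i => if i ∈ H then leftOp (theta A i) else leftOp (del A i) - rightOp (del A i)

/-- The creation operators of the morphism complex. -/
noncomputable def homCreation (H : Finset (Fin n)) :
    Fin n ⊕ Fin n → Module.End A (Module.End A (ExtMod n A)) :=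
  Sum.elim (fun i => rightOp (del A i))
    fun i => if i ∈ H then leftOp (del A i) - rightOp (del A i) else leftOp (theta A i)

theorem anticommutator_leftOp_theta_theta (i j : Fin n) :
    anticommutator (leftOp (theta A i)) (leftOp (theta A j)) = 0 := by
  rw [anticommutator_leftOp_leftOp, anticommutator_theta_theta, leftOp_zero]

theorem anticommutator_leftOp_del_del (i j : Fin n) :
    anticommutator (leftOp (del A i)) (leftOp (del A j)) = 0 := by
  rw [anticommutator_leftOp_leftOp, anticommutator_del_del, leftOp_zero]

theorem anticommutator_leftOp_theta_del (i j : Fin n) :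
    anticommutator (leftOp (theta A i)) (leftOp (del A j)) = if i = j then 1 else 0 := by
  rw [anticommutator_leftOp_leftOp, anticommutator_theta_del]
  split_ifs
  exacts [leftOp_one, leftOp_zero]

theorem anticommutator_rightOp_theta_theta (i j : Fin n) :
    anticommutator (rightOp (theta A i)) (rightOp (theta A j)) = 0 := by
  rw [anticommutator_rightOp_rightOp (anticommutator_parity_theta i)
    (anticommutator_parity_theta j), anticommutator_theta_theta, LinearMap.mulRight_zero_eq_zero,
    end_neg_zero]

theorem anticommutator_rightOp_del_del (i j : Fin n) :
    anticommutator (rightOp (del A i)) (rightOp (del A j)) = 0 := by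
  rw [anticommutator_rightOp_rightOp (anticommutator_parity_del i)
    (anticommutator_parity_del j), anticommutator_del_del, LinearMap.mulRight_zero_eq_zero,
    end_neg_zero]

theorem anticommutator_rightOp_theta_del (i j : Fin n) :
    anticommutator (rightOp (theta A i)) (rightOp (del A j)) = if i = j then -1 else 0 := by
  rw [anticommutator_rightOp_rightOp (anticommutator_parity_theta i)
    (anticommutator_parity_del j), anticommutator_theta_del]
  split_ifs
  · rw [LinearMap.mulRight_one]; rfl
  · rw [LinearMap.mulRight_zero_eq_zero, end_neg_zero]

theorem anticommutator_leftOp_theta_rightOp (i : Fin n) (y : Module.End A (ExtMod n A)) :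
    anticommutator (leftOp (theta A i)) (rightOp y) = 0 :=
  anticommutator_leftOp_rightOp (anticommutator_parity_theta i) y

theorem anticommutator_leftOp_del_rightOp (i : Fin n) (y : Module.End A (ExtMod n A)) :
    anticommutator (leftOp (del A i)) (rightOp y) = 0 :=
  anticommutator_leftOp_rightOp (anticommutator_parity_del i) y

theorem anticommutator_rightOp_leftOp_theta (i : Fin n) (y : Module.End A (ExtMod n A)) :
    anticommutator (rightOp y) (leftOp (theta A i)) = 0 := by
  rw [anticommutator_comm, anticommutator_leftOp_theta_rightOp]

theorem anticommutator_rightOp_leftOp_del (i : Fin n) (y : Module.End A (ExtMod n A)) :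
    anticommutator (rightOp y) (leftOp (del A i)) = 0 := by
  rw [anticommutator_comm, anticommutator_leftOp_del_rightOp]

theorem anticommutator_leftOp_del_theta (i j : Fin n) :
    anticommutator (leftOp (del A i)) (leftOp (theta A j)) = if i = j then 1 else 0 := by
  rw [anticommutator_comm, anticommutator_leftOp_theta_del]
  simp only [eq_comm]

theorem anticommutator_rightOp_del_theta (i j : Fin n) :
    anticommutator (rightOp (del A i)) (rightOp (theta A j)) = if i = j then -1 else 0 := by
  rw [anticommutator_comm, anticommutator_rightOp_theta_del]
  simp only [eq_comm]

/-- `L_x - R_x` is the supercommutator with `x`. For `θ_i` and `∂_j` the left part gives `δ_{ij}`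
and the right part `-δ_{ij}`, so they cancel. A bare `L_{θ_i}` occurs only for `i ∈ H` and the
supercommutator with `∂_j` only for `j ∉ H`, so these never share an index. -/
theorem anticommutator_homAnnihilation (H : Finset (Fin n)) (s t : Fin n ⊕ Fin n) :
    anticommutator (homAnnihilation (A := A) H s) (homAnnihilation H t) = 0 := by
  rcases s with i | i <;> rcases t with j | j <;>
    simp only [homAnnihilation, Sum.elim_inl, Sum.elim_inr] <;> (try split_ifs) <;>
    simp only [anticommutator_sub_left, anticommutator_sub_right,
      anticommutator_leftOp_theta_theta, anticommutator_leftOp_del_del,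
      anticommutator_leftOp_theta_del, anticommutator_rightOp_theta_theta,
      anticommutator_rightOp_del_del, anticommutator_rightOp_theta_del,
      anticommutator_leftOp_theta_rightOp, anticommutator_leftOp_del_rightOp,
      anticommutator_rightOp_leftOp_theta, anticommutator_rightOp_leftOp_del,
      anticommutator_leftOp_del_theta, anticommutator_rightOp_del_theta] <;>
    rcases eq_or_ne i j with h | h <;> (try simp_all) <;>
    exact LinearMap.ext fun φ => LinearMap.ext fun v => by simp

theorem homAnnihilation_mul_self (H : Finset (Fin n)) (t : Fin n ⊕ Fin n) :
    homAnnihilation (A := A) H t * homAnnihilation H t = 0 := by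
  have hr : ∀ {x : Module.End A (ExtMod n A)}, anticommutator (parity n A) x = 0 → x * x = 0 →
      rightOp x * rightOp x = 0 := by
    intro x hx h
    rw [rightOp_mul_rightOp x hx, h, LinearMap.mulRight_zero_eq_zero, end_neg_zero]
  -- Here `t.elim id id` is just the index underlying `t`. The squares are computed directly so that
  -- characteristic `2` is covered.
  have hθ : (leftOp (theta A (t.elim id id)) - rightOp (theta A (t.elim id id)))
      * (leftOp (theta A (t.elim id id)) - rightOp (theta A (t.elim id id))) = 0 := by
    rw [sub_mul_sub_self, leftOp_mul_leftOp, theta_mul_self, leftOp_zero,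
      anticommutator_leftOp_theta_rightOp, hr (anticommutator_parity_theta _) (theta_mul_self _),
      end_zero_sub_zero_add_zero]
  have hd : (leftOp (del A (t.elim id id)) - rightOp (del A (t.elim id id)))
      * (leftOp (del A (t.elim id id)) - rightOp (del A (t.elim id id))) = 0 := by
    rw [sub_mul_sub_self, leftOp_mul_leftOp, del_mul_self, leftOp_zero,
      anticommutator_leftOp_del_rightOp, hr (anticommutator_parity_del _) (del_mul_self _),
      end_zero_sub_zero_add_zero]
  rcases t with i | i
  · exact hθ
  · simp only [homAnnihilation, Sum.elim_inr]
    split_ifs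
    · rw [leftOp_mul_leftOp, theta_mul_self, leftOp_zero]
    · exact hd

theorem anticommutator_homAnnihilation_homCreation (H : Finset (Fin n)) (s t : Fin n ⊕ Fin n) :
    anticommutator (homAnnihilation (A := A) H s) (homCreation H t) = if s = t then 1 else 0 := by
  rcases s with i | i <;> rcases t with j | j <;>
    simp only [homAnnihilation, homCreation, Sum.elim_inl, Sum.elim_inr] <;> (try split_ifs) <;>
    simp only [anticommutator_sub_left, anticommutator_sub_right,
      anticommutator_leftOp_theta_theta, anticommutator_leftOp_del_del,
      anticommutator_leftOp_theta_del, anticommutator_rightOp_del_del, anticommutator_rightOp_theta_del,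
      anticommutator_leftOp_theta_rightOp, anticommutator_leftOp_del_rightOp,
      anticommutator_rightOp_leftOp_theta, anticommutator_rightOp_leftOp_del,
      anticommutator_leftOp_del_theta] <;>
    rcases eq_or_ne i j with h | h <;> (try simp_all) <;>
    exact LinearMap.ext fun φ => LinearMap.ext fun v => by simp

/-- The coefficient of `θ_H` as a linear form. -/
noncomputable def vacuumForm (H : Finset (Fin n)) : Module.End A (ExtMod n A) →ₗ[A] A :=
  LinearMap.proj H ∘ₗ LinearMap.applyₗ (thetaBasis A ∅)

theorem vacuumForm_apply (H : Finset (Fin n)) (φ : Module.End A (ExtMod n A)) :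
    vacuumForm H φ = φ (thetaBasis A ∅) H := rfl

/-- `R_{∂_i} φ` kills `1`; the image of `∂_i` has no `θ_H` component if `i ∈ H`, and that of `θ_i`
has none if `i ∉ H`. This dictates the case split on `H`. -/
theorem vacuumForm_homCreation (H : Finset (Fin n)) (t : Fin n ⊕ Fin n)
    (φ : Module.End A (ExtMod n A)) : vacuumForm H (homCreation H t φ) = 0 := by
  have hr : ∀ i, rightOp (del A i) φ (thetaBasis A ∅) = 0 := by
    intro i
    rw [rightOp_apply, Module.End.mul_apply, del_thetaBasis_of_notMem (Finset.notMem_empty i),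
      map_zero]
  rcases t with i | i
  · rw [vacuumForm_apply, homCreation, Sum.elim_inl, hr, Pi.zero_apply]
  · rw [vacuumForm_apply, homCreation, Sum.elim_inr]
    split_ifs with h
    · rw [LinearMap.sub_apply, LinearMap.sub_apply, hr, sub_zero, leftOp_apply,
        Module.End.mul_apply, del_apply, if_pos h]
    · rw [leftOp_apply, Module.End.mul_apply, theta_apply, if_neg h]

theorem vacuumForm_thetaOp (H : Finset (Fin n)) : vacuumForm H (thetaOp A H) = 1 := by
  rw [vacuumForm_apply, thetaOp_thetaBasis_empty, thetaBasis_apply, if_pos rfl]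

/-- `θ_H` supercommutes with all `θ_i` and with `∂_i` for `i ∉ H`, while `θ_i θ_H = 0` for `i ∈ H`.
So `θ_H` is the vacuum. -/
theorem homAnnihilation_thetaOp (H : Finset (Fin n)) (t : Fin n ⊕ Fin n) :
    homAnnihilation H t (thetaOp A H) = 0 := by
  have hmove : ∀ (x : Module.End A (ExtMod n A)) (l : List (Fin n)),
      (∀ a ∈ l, anticommutator x (theta A a) = 0) →
      x * (l.map (theta A)).prod = rightOp x (l.map (theta A)).prod := by
    intro x l
    rw [rightOp_apply]
    induction l with
    | nil => simp [parity_mul_self]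
    | cons a l ih =>
      intro h
      refine LinearMap.ext fun v => ?_
      have h1 := LinearMap.congr_fun (ih fun b hb => h b (List.mem_cons_of_mem a hb)) v
      simp only [Module.End.mul_apply] at h1
      simp only [List.map_cons, List.prod_cons, Module.End.mul_apply]
      rw [mul_eq_neg_of_anticommutator (h a List.mem_cons_self), h1,
        mul_eq_neg_of_anticommutator (anticommutator_parity_theta a)]
  have hz : ∀ (i : Fin n) (l : List (Fin n)), i ∈ l →
      theta A i * (l.map (theta A)).prod = 0 := by
    intro i l
    induction l with
    | nil => simp
    | cons a l ih =>
      intro hi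
      rw [List.map_cons, List.prod_cons]
      by_cases h : i = a
      · rw [h, ← mul_assoc, theta_mul_self, zero_mul]
      · refine LinearMap.ext fun v => ?_
        have h1 := LinearMap.congr_fun (ih ((List.mem_cons.1 hi).resolve_left h)) v
        rw [Module.End.mul_apply] at h1
        rw [Module.End.mul_apply, Module.End.mul_apply,
          mul_eq_neg_of_anticommutator (anticommutator_theta_theta i a), h1]
        simp
  rcases t with i | i
  · rw [homAnnihilation, Sum.elim_inl, LinearMap.sub_apply, leftOp_apply,
      thetaOp, hmove _ _ fun a _ => anticommutator_theta_theta i a, sub_self]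
  · rw [homAnnihilation, Sum.elim_inr]
    split_ifs with h
    · rw [leftOp_apply, thetaOp, hz i _ (by simpa using h)]
    · rw [LinearMap.sub_apply, leftOp_apply, thetaOp, hmove, sub_self]
      intro a ha
      rw [anticommutator_del_theta, if_neg]
      rintro rfl
      exact h (by simpa using ha)

/-- The rank count `2ⁿ · 2ⁿ = 2^{n+n}` required by `exists_sum_apply_eq`. -/
theorem nonempty_end_equiv (n : ℕ) (A : Type u) [CommRing A] :
    Nonempty (Module.End A (ExtMod n A) ≃ₗ[A] ExtMod (n + n) A) := by
  have h : Fintype.card (Finset (Fin n) × Finset (Fin n)) = Fintype.card (Finset (Fin (n + n))) := by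
    simp [pow_add]
  exact ⟨LinearMap.toMatrix'.trans ((LinearEquiv.curry A A _ _).symm.trans
    (LinearEquiv.funCongrLeft A A (Fintype.equivOfCardEq h).symm))⟩

end Operators

/-! ### The differential of the morphism complex in creation and annihilation operators -/

section Differential

variable {n : ℕ} {A : Type u} [CommRing A]

/-- The coefficients of the annihilation operators in the differential of the morphism complex
from the Koszul matrix factorization of `x₁`, `v₁` to that of `x₂`, `v₂`. -/
def annihilationCoeff (H : Finset (Fin n)) (x₁ x₂ v₂ : Fin n → A) : Fin n ⊕ Fin n → A :=
  Sum.elim x₁ fun i => if i ∈ H then x₂ i - x₁ i else v₂ i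

/-- The coefficients of the creation operators in the differential of the morphism complex
from the Koszul matrix factorization of `x₁`, `v₁` to that of `x₂`, `v₂`. -/
def creationCoeff (H : Finset (Fin n)) (x₁ v₁ x₂ v₂ : Fin n → A) : Fin n ⊕ Fin n → A :=
  Sum.elim (fun i => v₂ i - v₁ i) fun i => if i ∈ H then v₂ i else x₂ i - x₁ i

/-- For each `i` the two products add up to `x₂ v₂ - x₁ v₁`, whether or not `i ∈ H`. The total is
the difference of the two potentials. -/
theorem sum_creationCoeff_mul_annihilationCoeff (H : Finset (Fin n)) (x₁ v₁ x₂ v₂ : Fin n → A) :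
    ∑ t, creationCoeff H x₁ v₁ x₂ v₂ t * annihilationCoeff H x₁ x₂ v₂ t
      = ∑ i, x₂ i * v₂ i - ∑ i, x₁ i * v₁ i := by
  rw [Fintype.sum_sum_type, ← Finset.sum_add_distrib, ← Finset.sum_sub_distrib]
  refine Finset.sum_congr rfl fun i _ => ?_
  simp only [creationCoeff, annihilationCoeff, Sum.elim_inl, Sum.elim_inr]
  split_ifs <;> ring

/-- The differential of the morphism complex from the Koszul matrix factorization of `x₁`, `v₁` to
that of `x₂`, `v₂`; see `homDifferential_apply`. -/
noncomputable def homDifferential (H : Finset (Fin n)) (x₁ v₁ x₂ v₂ : Fin n → A) :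
    Module.End A (Module.End A (ExtMod n A)) :=
  ∑ t, (creationCoeff H x₁ v₁ x₂ v₂ t • homCreation H t
    + annihilationCoeff H x₁ x₂ v₂ t • homAnnihilation H t)

/-- For every `i` the terms regroup to `x₂ L_θ + v₂ L_∂ - x₁ R_θ - v₁ R_∂`; the result does not
depend on `H`. -/
theorem homDifferential_apply (H : Finset (Fin n)) (x₁ v₁ x₂ v₂ : Fin n → A)
    (φ : Module.End A (ExtMod n A)) (v : ExtMod n A) :
    homDifferential H x₁ v₁ x₂ v₂ φ v
      = koszulD x₂ v₂ (φ v) - parity n A (φ (parity n A (koszulD x₁ v₁ v))) := by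
  have h : ∀ x : Module.End A (ExtMod n A), rightOp x φ v = parity n A (φ (parity n A (x v))) := by
    intro x
    rw [rightOp_apply]
    rfl
  have h' : ∀ x : Module.End A (ExtMod n A), leftOp x φ v = x (φ v) := fun _ => rfl
  simp only [homDifferential, koszulD, LinearMap.sum_apply, map_sum, LinearMap.add_apply, LinearMap.smul_apply,
    map_add, map_smul]
  rw [Fintype.sum_sum_type, ← Finset.sum_add_distrib, ← Finset.sum_sub_distrib]
  refine Finset.sum_congr rfl fun i _ => ?_
  simp only [creationCoeff, annihilationCoeff, homCreation, homAnnihilation, Sum.elim_inl,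
    Sum.elim_inr]
  split_ifs <;> simp only [LinearMap.sub_apply, h, h'] <;> module

end Differential

/-! ### Leading coefficients determine cohomology classes -/

section Main

variable {k : Type u} [Field k] {n : ℕ} {G : Type*} [CommGroup G] {W : MvPolynomial (Fin n) k}
  {χ : G →* (Fin n → kˣ)} {hW : ∀ g, IsInvariant W (χ g)}

open MatrixFactorization

theorem D_Delta_apply {h : G} (φ : hom (Delta W χ hW 1) (Delta W χ hW h))
    (v : ExtMod n (DoubleRing k n)) :
    D (Delta W χ hW 1) (Delta W χ hW h) φ v
      = homDifferential (movedSet χ h) (twX (χ 1)) (twNabla W (χ 1)) (twX (χ h))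
          (twNabla W (χ h)) φ v := by
  refine (D_apply φ v).trans ((homDifferential_apply _ _ _ _ _ φ v).trans ?_).symm
  have h1 : ∀ z, (Delta W χ hW 1).sgn z = parity n _ z := sgn_koszul_apply _ _ _ _
  have h2 : ∀ z, (Delta W χ hW h).sgn z = parity n _ z := sgn_koszul_apply _ _ _ _
  rw [h2, h1]
  rfl

theorem isNullhomotopic_of_leadingCoeff_eq_zero (hiso : Module.Finite k (Jac W)) {h : G}
    {φ : hom (Delta W χ hW 1) (Delta W χ hW h)} (hφ : IsClosed φ) (h0 : leadingCoeff φ = 0) :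
    IsNullhomotopic φ := by
  let H := movedSet χ h
  let S := DoubleRing k n
  have hmem : ∀ i, i ∈ H ↔ χ h i ≠ 1 := by
    intro i
    simp [H, movedSet]
  let e : Fin (n + n) ≃ Fin n ⊕ Fin n := finSumFinEquiv.symm
  let a : Fin n ⊕ Fin n → S :=
    creationCoeff H (twX (χ 1)) (twNabla W (χ 1)) (twX (χ h)) (twNabla W (χ h))
  let b : Fin n ⊕ Fin n → S := annihilationCoeff H (twX (χ 1)) (twX (χ h)) (twNabla W (χ h))
  let ι : Fin (n + n) → Module.End S (Module.End S (ExtMod n S)) :=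
    fun i => homAnnihilation H (e i)
  let E : Fin (n + n) → Module.End S (Module.End S (ExtMod n S)) := fun i => homCreation H (e i)
  have hsum : ∑ i, (a (e i) • E i + b (e i) • ι i)
      = homDifferential H (twX (χ 1)) (twNabla W (χ 1)) (twX (χ h)) (twNabla W (χ h)) :=
    e.sum_comp fun t => a t • homCreation H t + b t • homAnnihilation H t
  -- `Δ_1` and `Δ_h` factor the same potential `W(y) - W(x)`.
  have hab : ∑ i, a (e i) * b (e i) = 0 := by
    rw [e.sum_comp fun t => a t * b t]
    refine (sum_creationCoeff_mul_annihilationCoeff _ _ _ _ _).trans ?_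
    rw [sum_twX_mul_twNabla (hW h), sum_twX_mul_twNabla (hW 1), sub_self]
  have hb : ∀ t, b t ∈ Ideal.span (Set.range fun i => b (e i)) := fun t =>
    Ideal.subset_span ⟨e.symm t, by simp⟩
  have hfin : Module.Finite k (S ⧸ Ideal.span (Set.range fun i => b (e i))) := by
    refine finite_quotient_of_finite_jac (hW h) hiso (fun i => ?_) (fun i hi => ?_)
      (fun i hi => ?_)
    · have := hb (Sum.inl i)
      rwa [show b (Sum.inl i) = twX (χ 1) i from rfl, map_one] at this
    · have := hb (Sum.inr i)
      rwa [show b (Sum.inr i) = twX (χ h) i - twX (χ 1) i from if_pos ((hmem i).2 hi),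
        map_one] at this
    · have := hb (Sum.inr i)
      rwa [show b (Sum.inr i) = twNabla W (χ h) i from
        if_neg fun hi' => (hmem i).1 hi' hi] at this
  -- There are as many coefficients `b` as variables of `S`, namely `2n`, and `hfin` supplies the
  -- finite codimension.
  have hex := exists_contraction_eq (σ := Fin n ⊕ Fin n) (by simp) fun i => b (e i)
  obtain ⟨f⟩ := nonempty_end_equiv n S
  have hcl : (∑ i, (a (e i) • E i + b (e i) • ι i)) φ = 0 := by
    rw [hsum]
    refine LinearMap.ext fun v => ?_
    refine (D_Delta_apply φ v).symm.trans ?_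
    rw [show D (Delta W χ hW 1) (Delta W χ hW h) φ = 0 from hφ]
    rfl
  obtain ⟨s, hs⟩ := exists_sum_apply_eq f
    (fun i j => anticommutator_homAnnihilation H (e i) (e j))
    (fun i => homAnnihilation_mul_self H (e i))
    (fun i j => (anticommutator_homAnnihilation_homCreation H (e i) (e j)).trans
      (by simp only [e.injective.eq_iff]))
    (fun i x => vacuumForm_homCreation H (e i) x)
    (fun i => homAnnihilation_thetaOp H (e i)) (vacuumForm_thetaOp H) hab hex hcl
    ((coeff_empty H φ).symm.trans h0)
  refine ⟨s, LinearMap.ext fun v => (D_Delta_apply s v).trans ?_⟩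
  rw [hsum] at hs
  exact LinearMap.congr_fun hs v

theorem cls_eq_of_leadingCoeff_eq (hiso : Module.Finite k (Jac W)) {h : G}
    {φ φ' : hom (Delta W χ hW 1) (Delta W χ hW h)} (hφ : IsClosed φ) (hφ' : IsClosed φ')
    (e : leadingCoeff φ = leadingCoeff φ') : cls φ hφ = cls φ' hφ' := by
  rw [cls_eq_cls]
  refine isNullhomotopic_of_leadingCoeff_eq_zero hiso ?_ ?_
  · unfold MatrixFactorization.IsClosed at *
    rw [map_sub, hφ, hφ', sub_zero]
  · have h1 : ∀ ψ : hom (Delta W χ hW 1) (Delta W χ hW h),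
        leadingCoeff ψ = vacuumForm (movedSet χ h) ψ := fun ψ => coeff_empty _ ψ
    rw [h1] at e ⊢
    rw [h1] at e
    exact (map_sub (vacuumForm (movedSet χ h)) φ φ').trans (sub_eq_zero.2 e)

end Main

end TwistedMF

theorem mainTheorem5 {k : Type*} [Field k] {n : ℕ} (W : MvPolynomial (Fin n) k)
    {G : Type*} [CommGroup G] [Finite G] (χ : G →* (Fin n → kˣ))
    (hW : ∀ g, TwistedMF.IsInvariant W (χ g)) (hiso : Module.Finite k (TwistedMF.Jac W)) :
    -- a closed morphism whose leading coefficient vanishes is nullhomotopic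
    (∀ (h : G) (φ : (TwistedMF.Delta W χ hW 1).hom (TwistedMF.Delta W χ hW h)),
      TwistedMF.MatrixFactorization.IsClosed φ → TwistedMF.leadingCoeff φ = 0 →
        TwistedMF.MatrixFactorization.IsNullhomotopic φ) ∧
    -- a cohomology class is determined by its leading coefficient
    (∀ (h : G) (φ φ' : (TwistedMF.Delta W χ hW 1).hom (TwistedMF.Delta W χ hW h))
      (hφ : TwistedMF.MatrixFactorization.IsClosed φ)
      (hφ' : TwistedMF.MatrixFactorization.IsClosed φ'),
      TwistedMF.leadingCoeff φ = TwistedMF.leadingCoeff φ' →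
        TwistedMF.MatrixFactorization.cls φ hφ = TwistedMF.MatrixFactorization.cls φ' hφ') ∧
    -- a product class is computed by the leading coefficient of the composite `(h_* φ) ∘ ψ`
    (∀ (g h : G) (φ : (TwistedMF.Delta W χ hW 1).hom (TwistedMF.Delta W χ hW g))
      (ψ : (TwistedMF.Delta W χ hW 1).hom (TwistedMF.Delta W χ hW h))
      (ω : (TwistedMF.Delta W χ hW 1).hom (TwistedMF.Delta W χ hW (g * h)))
      (hφ : TwistedMF.MatrixFactorization.IsClosed φ)
      (hψ : TwistedMF.MatrixFactorization.IsClosed ψ)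
      (hω : TwistedMF.MatrixFactorization.IsClosed ω),
      TwistedMF.leadingCoeff ω = TwistedMF.leadingCoeff (TwistedMF.push W χ hW h φ ∘ₗ ψ) →
        TwistedMF.cupHom (TwistedMF.MatrixFactorization.cls φ hφ)
          (TwistedMF.MatrixFactorization.cls ψ hψ) = TwistedMF.MatrixFactorization.cls ω hω) ∧
    -- a product class depends only on the leading coefficients of the two factors
    (∀ (g h : G) (φ φ' : (TwistedMF.Delta W χ hW 1).hom (TwistedMF.Delta W χ hW g))
      (ψ ψ' : (TwistedMF.Delta W χ hW 1).hom (TwistedMF.Delta W χ hW h))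
      (hφ : TwistedMF.MatrixFactorization.IsClosed φ)
      (hφ' : TwistedMF.MatrixFactorization.IsClosed φ')
      (hψ : TwistedMF.MatrixFactorization.IsClosed ψ)
      (hψ' : TwistedMF.MatrixFactorization.IsClosed ψ'),
      TwistedMF.leadingCoeff φ = TwistedMF.leadingCoeff φ' →
      TwistedMF.leadingCoeff ψ = TwistedMF.leadingCoeff ψ' →
        TwistedMF.cupHom (TwistedMF.MatrixFactorization.cls φ hφ)
          (TwistedMF.MatrixFactorization.cls ψ hψ) =
        TwistedMF.cupHom (TwistedMF.MatrixFactorization.cls φ' hφ')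
          (TwistedMF.MatrixFactorization.cls ψ' hψ')) := by

  refine ⟨fun h φ hφ h0 => TwistedMF.isNullhomotopic_of_leadingCoeff_eq_zero hiso hφ h0,
    fun h φ φ' hφ hφ' e => TwistedMF.cls_eq_of_leadingCoeff_eq hiso hφ hφ' e,
    fun g h φ ψ ω hφ hψ hω e => ?_, fun g h φ φ' ψ ψ' hφ hφ' hψ hψ' e e' => ?_⟩
  -- The product class is represented by the closed composite `(h_* φ) ∘ ψ`, to which the second
  -- claim applies.
  · rw [TwistedMF.cupHom_cls]
    exact TwistedMF.cls_eq_of_leadingCoeff_eq hiso _ hω e.symm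
  · rw [TwistedMF.cls_eq_of_leadingCoeff_eq hiso hφ hφ' e,
      TwistedMF.cls_eq_of_leadingCoeff_eq hiso hψ hψ' e']
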